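/- Let $d\ge 1$ and let $f:\mathbb{R}^d\to[0,\infty)$ be a spherically symmetric probability density with a regularly varying tail of exponent $\alpha>d$: for every $\theta\in\mathbb{S}^{d-1}$ and $r>0$, $\lim_{t\to\infty} f(tr\theta)/f(t\theta)=r^{-\alpha}$. For every $n\ge1$ let $\mathcal P_n$ be a Poisson point process on $\mathbb{R}^d$ with intensity $nf$ (almost surely a finite set), and let $m=m(n)$ be positive integers with $m(n)\to\infty$ and $m(n)/n\to0$ as $n\to\infty$. Let $k\ge1$. If $k=1$ put $h_1\equiv1$; if $k\ge2$ let $h_k:(\mathbb{R}^d)^k\to\{0,1\}$ be a measurable function that is invariant under permutations of its $k$ arguments, is translation invariant, i.e. $h_k(x+y_1,\dots,x+y_k)=h_k(y_1,\dots,y_k)$, vanishes whenever the Euclidean diameter of $\{y_1,\dots,y_k\}$ exceeds some constant $L\in(0,\infty)$, and satisfies $\int_{(\mathbb{R}^d)^{k-1}}h_k(0,z_1,\dots,z_{k-1})\,dz_1\cdots dz_{k-1}>0$. For a $k$-point set $\mathcal Y=\{y_1,\dots,y_k\}$ write $h_k(\mathcal Y)=h_k(y_1,\dots,y_k)$ and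 $\min(\mathcal Y)=\min_{1\le i\le k}|y_i|$ with $|\cdot|$ the Euclidean norm. Let $U_k(1)\ge U_k(2)\ge\cdots$ be the order statistics, in decreasing order, of the values $h_k(\mathcal Y)\min(\mathcal Y)$ over all $k$-point subsets $\mathcal Y\subset\mathcal P_n$ (with $U_k(j)=0$ if there are fewer than $j$ such subsets), and define the $k$-th layered Hill estimator $$H_{k,m,n}=\frac1{m^k}\sum_{\mathcal Y\subset\mathcal P_n,\ |\mathcal Y|=k}h_k(\mathcal Y)\,\log\Big(\max\Big\{\frac{\min(\mathcal Y)}{U_k(m^k)},\,1\Big\}\Big),$$ with $H_{k,m,n}=0$ if $U_k(m^k)=0$. Then, as $n\to\infty$, $$H_{k,m,n}\to\frac1{\alpha k-d}\quad\text{in probability};$$ equivalently, $d/k+(kH_{k,m,n})^{-1}\to\alpha$ in probability. -/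

import Mathlib

open MeasureTheory ProbabilityTheory Filter Topology
open scoped NNReal ENNReal

noncomputable section

namespace LayeredHill

/-- The number of points of the finite set `s` that lie in `B`. -/
def count {E : Type*} (s : Finset E) (B : Set E) : ℕ := ((s : Set E) ∩ B).ncard

/-- `N` is a Poisson point process (a random finite set) with finite intensity measure `Λ`:
the number of points in a measurable set `B` is a Poisson random variable of mean `Λ B`,
and the numbers of points in pairwise disjoint measurable sets are independent. -/
structure IsPoissonProcess {Ω E : Type*} [MeasurableSpace Ω] [MeasurableSpace E]
    (N : Ω → Finset E) (Λ : Measure E) (μ : Measure Ω) : Prop where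
  finite : Λ Set.univ < ∞
  measurable_count : ∀ B : Set E, MeasurableSet B → Measurable fun ω => count (N ω) B
  law_count : ∀ B : Set E, MeasurableSet B →
    μ.map (fun ω => count (N ω) B) = poissonMeasure (Λ B).toNNReal
  indep_count : ∀ (j : ℕ) (B : Fin j → Set E), (∀ i, MeasurableSet (B i)) →
    (∀ i i', i ≠ i' → Disjoint (B i) (B i')) → iIndepFun (fun i ω => count (N ω) (B i)) μ

/-- `f` is a spherically symmetric probability density on `ℝ^d` whose tail is regularly varying
with exponent `α > d`. -/
structure IsRegVaryingDensity {d : ℕ} (f : EuclideanSpace ℝ (Fin d) → ℝ) (α : ℝ) : Prop where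
  measurable : Measurable f
  nonneg : ∀ x, 0 ≤ f x
  lintegral_eq_one : ∫⁻ x, ENNReal.ofReal (f x) = 1
  spherically_symmetric : ∀ x y, ‖x‖ = ‖y‖ → f x = f y
  lt_exponent : (d : ℝ) < α
  tail : ∀ θ : EuclideanSpace ℝ (Fin d), ‖θ‖ = 1 → ∀ r : ℝ, 0 < r →
    Tendsto (fun t : ℝ => f ((t * r) • θ) / f (t • θ)) atTop (𝓝 (r ^ (-α)))

/-- The vector `(0, z₁, …, z_{k-1})`. -/
def consZero {d k : ℕ} (z : Fin (k - 1) → EuclideanSpace ℝ (Fin d)) :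
    Fin k → EuclideanSpace ℝ (Fin d) :=
  fun i => if hi : (i : ℕ) = 0 then 0 else z ⟨(i : ℕ) - 1, by omega⟩

/-- `h` is an admissible indicator function on `(ℝ^d)^k`, imposing the geometric constraint. -/
structure IsAdmissible {d k : ℕ} (h : (Fin k → EuclideanSpace ℝ (Fin d)) → ℝ) : Prop where
  measurable : Measurable h
  zero_or_one : ∀ y, h y = 0 ∨ h y = 1
  eq_one_of_single : k = 1 → ∀ y, h y = 1
  perm_invariant : ∀ (σ : Equiv.Perm (Fin k)) y, h (fun i => y (σ i)) = h y
  translation_invariant : ∀ x y, h (fun i => x + y i) = h y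
  local_support : ∃ L : ℝ, 0 < L ∧ ∀ y, L < Metric.diam (Set.range y) → h y = 0
  integral_pos : 0 < ∫ z : Fin (k - 1) → EuclideanSpace ℝ (Fin d), h (consZero z)

/-- `h(𝒴) = h(y₁, …, y_k)` for a `k`-point set `𝒴 = {y₁, …, y_k}` (the enumeration is irrelevant
when `h` is permutation invariant). -/
def onSet {E : Type*} {k : ℕ} (h : (Fin k → E) → ℝ) (Y : Finset E) : ℝ :=
  if hY : Y.card = k then h (fun i => ((Y.equivFinOfCardEq hY).symm i : E)) else 0

/-- `min(𝒴)`, the smallest Euclidean norm of a point of `𝒴` (and `0` for the empty set). -/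
def minNorm {E : Type*} [Norm E] (Y : Finset E) : ℝ :=
  if hY : Y.Nonempty then Y.inf' hY (fun y => ‖y‖) else 0

/-- `U_k(j)`: the `j`-th largest (`j ≥ 1`, counted with multiplicity) of the values
`h(𝒴) min(𝒴)`, where `𝒴` ranges over the `k`-point subsets of `s`; it is `0` if there are fewer
than `j` such subsets. -/
def orderStat {E : Type*} [Norm E] {k : ℕ} (h : (Fin k → E) → ℝ) (s : Finset E) (j : ℕ) : ℝ :=
  (((s.powersetCard k).val.map fun Y => onSet h Y * minNorm Y).sort (· ≥ ·)).getD (j - 1) 0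

/-- The `k`-th layered Hill estimator of the point set `s` with cut-off `m`:
`m^{-k} ∑_{𝒴 ⊆ s, |𝒴| = k} h(𝒴) log (max (min(𝒴) / U_k(m^k)) 1)`.
It is `0` when `U_k(m^k) = 0`, since the quotients are then `0`. -/
def hill {E : Type*} [Norm E] {k : ℕ} (h : (Fin k → E) → ℝ) (m : ℕ) (s : Finset E) : ℝ :=
  (1 / (m : ℝ) ^ k) *
    ∑ Y ∈ s.powersetCard k, onSet h Y * Real.log (max (minNorm Y / orderStat h s (m ^ k)) 1)

end LayeredHill

end

/-!
Write `f x = g ‖x‖`, let `k = K + 1`, and call a `k`-set admissible if `h` equals `1` on it. For a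
function `φ` on `[0, ∞)` the *layer sum* of `φ` is `∑ h(𝒴) φ(min 𝒴)` over the `k`-subsets of the
point process. Both the rank of the order statistic `U_k(m^k)` and the estimator itself are layer
sums, up to the random cut-off in the latter, so the theorem follows from a law of large numbers for
layer sums at the right scale.

*First moments.* Since counts in disjoint sets are independent Poisson variables, the expected sum of
a function over the tuples of distinct points is its integral against the power of the intensity
(`IsPoissonProcess.lintegral_sum_injTuples`); it suffices to check this on boxes with pairwise
disjoint sides, because countably many of them cover the complement of the diagonals. For weights
`φ(min 𝒴 / R)`, the substitution `y = (R u, R u + z₁, …, R u + z_K)` makes the integrand converge to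
`h(0, z) φ(‖u‖) ‖u‖^(-αk)` after division by `R^d g(R)^k`: the points of an admissible set are within
a bounded distance of each other, so their ratios to `R` all tend to `‖u‖`. The uniform convergence
theorem for regularly varying functions gives this limit along moving arguments, and Potter's bound
(`IsRegVarying.potter`) a dominating function; the result is `tendsto_kernelIntegral`.

*Second moments.* The square of a layer sum splits into disjoint and overlapping pairs of `k`-sets.
The disjoint pairs contribute exactly the square of the first moment
(`IsPoissonProcess.lintegral_sum_disjoint`). An overlapping pair is controlled by a local function of
its union, a set of `l` points with `k ≤ l < 2k` (`onSet_mul_onSet_le`), so the overlapping pairs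
contribute terms of order `(n g(R))^l R^d`. Hence Chebyshev's inequality applies as soon as these are
negligible compared with the squared first moment.

*The scale.* The expected number of admissible sets with minimum at least `R` is continuous in `R` and
tends to `0`, so as `m / n → 0` there are `R n → ∞` at which it equals `m^k` (`exists_scale`). There
`(n g(R))^k R^d` is of order `m^k`, which makes the overlapping terms negligible as `m → ∞`
(`pow_mul_pow_div_le`). With `β = αk - d`, this yields in probability
`m^(-k) #{admissible 𝒴 : min 𝒴 ≥ c R n} → c^(-β)` and
`m^(-k) ∑ h(𝒴) log (max (min 𝒴 / (c R n)) 1) → c^(-β) / β` for each `c > 0`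
(`tendstoInMeasure_layerSum`).

*Conclusion.* For `a < 1 < b` the first limit is larger than `1` at `c = a` and smaller than `1` at
`c = b`, so `a R n ≤ U_k(m^k) ≤ b R n` with probability tending to `1`. On this event the estimator
lies between the logarithmic layer sums with `c = b` and `c = a` (`hill_bounds`), and `a, b → 1` gives
the limit `1 / β` (`tendstoInMeasure_hill`).
-/

open MeasureTheory ProbabilityTheory Filter Topology
open scoped NNReal ENNReal

noncomputable section

namespace LayeredHill

/-! ### Regular variation -/

/-- The uniform convergence theorem in additive form: if the increments `ℓ (x + u) - ℓ x` of a
measurable function vanish at infinity for each fixed `u`, they vanish uniformly in `u ∈ [0, 1]`. -/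
theorem tendsto_increment_of_mem_Icc {ℓ : ℝ → ℝ} (hm : Measurable ℓ)
    (h : ∀ u, Tendsto (fun x => ℓ (x + u) - ℓ x) atTop (𝓝 0)) {x u : ℕ → ℝ}
    (hx : Tendsto x atTop atTop) (hu : ∀ n, u n ∈ Set.Icc (0 : ℝ) 1) :
    Tendsto (fun n => ℓ (x n + u n) - ℓ (x n)) atTop (𝓝 0) := by
  have key : ∀ y : ℕ → ℝ, Tendsto y atTop atTop → ∀ ε : ℝ, 0 < ε → ∀ᶠ n in atTop,
      volume.restrict (Set.Icc (0 : ℝ) 2) {v | ε ≤ ‖ℓ (y n + v) - ℓ (y n) - 0‖} < 1 / 3 := by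
    intro y hy ε hε
    have h1 : TendstoInMeasure (volume.restrict (Set.Icc (0 : ℝ) 2))
        (fun n v => ℓ (y n + v) - ℓ (y n)) atTop (fun _ => (0 : ℝ)) :=
      tendstoInMeasure_of_tendsto_ae
        (fun n => ((hm.comp (measurable_const_add _)).sub_const _).aestronglyMeasurable)
        (ae_of_all _ fun v => (h v).comp hy)
    rw [tendstoInMeasure_iff_norm] at h1
    exact (h1 ε hε).eventually (gt_mem_nhds (by simp))
  rw [Metric.tendsto_nhds]
  intro ε hε
  have hxu : Tendsto (fun n => x n + u n) atTop atTop :=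
    tendsto_atTop_mono (fun n => le_add_of_nonneg_right (hu n).1) hx
  filter_upwards [key x hx (ε / 2) (by positivity), key _ hxu (ε / 2) (by positivity)]
    with n hA hB
  have hmA : MeasurableSet {v | ε / 2 ≤ ‖ℓ (x n + v) - ℓ (x n) - 0‖} :=
    measurableSet_le measurable_const (by fun_prop)
  have hmB : MeasurableSet {v | ε / 2 ≤ ‖ℓ (x n + u n + v) - ℓ (x n + u n) - 0‖} :=
    measurableSet_le measurable_const (by fun_prop)
  rw [Measure.restrict_apply hmA] at hA
  rw [Measure.restrict_apply hmB] at hB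
  set A := {v | ε / 2 ≤ ‖ℓ (x n + v) - ℓ (x n) - 0‖} ∩ Set.Icc (0 : ℝ) 2 with hAdef
  set B := {v | ε / 2 ≤ ‖ℓ (x n + u n + v) - ℓ (x n + u n) - 0‖} ∩ Set.Icc (0 : ℝ) 2 with hBdef
  -- The exceptional sets are too small to cover `[1, 2]`.
  have hB' : volume ((fun v => v - u n) ⁻¹' B) < 1 / 3 := by
    simp only [sub_eq_add_neg]
    rw [measure_preimage_add_right]; exact hB
  have hlt : volume (A ∪ (fun v => v - u n) ⁻¹' B) < volume (Set.Icc (1 : ℝ) 2) := by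
    refine (measure_union_le _ _).trans_lt ((ENNReal.add_lt_add hA hB').trans_le ?_)
    rw [Real.volume_Icc]
    rw [show ((2 : ℝ) - 1) = 1 by norm_num, ENNReal.ofReal_one, ENNReal.div_add_div_same,
      one_add_one_eq_two]
    refine ENNReal.div_le_of_le_mul ?_
    norm_num
  obtain ⟨v, hv, hvn⟩ : ∃ v ∈ Set.Icc (1 : ℝ) 2, v ∉ A ∪ (fun v => v - u n) ⁻¹' B := by
    by_contra hcon
    push Not at hcon
    exact absurd (measure_mono (μ := volume) hcon) (not_le.mpr hlt)
  have hun := hu n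
  simp only [Set.mem_union, not_or, Set.mem_preimage, hAdef, hBdef, Set.mem_inter_iff,
    Set.mem_ofPred_eq, not_and, not_le, Set.mem_Icc] at hvn hv hun
  have h1 : ‖ℓ (x n + v) - ℓ (x n) - 0‖ < ε / 2 := by
    by_contra hc
    exact absurd (hvn.1 (not_lt.mp hc) (by linarith)) (by linarith)
  have h2 : ‖ℓ (x n + u n + (v - u n)) - ℓ (x n + u n) - 0‖ < ε / 2 := by
    by_contra hc
    exact absurd (hvn.2 (not_lt.mp hc) (by linarith)) (by linarith)
  rw [show x n + u n + (v - u n) = x n + v by ring] at h2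
  rw [Real.dist_eq]
  simp only [sub_zero, Real.norm_eq_abs, abs_lt] at h1 h2 ⊢
  constructor <;> linarith

theorem exists_forall_abs_increment_le {ℓ : ℝ → ℝ} (hm : Measurable ℓ)
    (h : ∀ u, Tendsto (fun x => ℓ (x + u) - ℓ x) atTop (𝓝 0)) {ε : ℝ} (hε : 0 < ε) :
    ∃ X, ∀ x ≥ X, ∀ u ∈ Set.Icc (0 : ℝ) 1, |ℓ (x + u) - ℓ x| ≤ ε := by
  by_contra! hcon
  choose x hx u hu hlt using fun n : ℕ => hcon (n : ℝ)
  have h1 := tendsto_increment_of_mem_Icc hm h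
    (tendsto_atTop_mono hx tendsto_natCast_atTop_atTop) hu
  rw [Metric.tendsto_nhds] at h1
  obtain ⟨n, hn⟩ := (h1 ε hε).exists
  rw [Real.dist_eq, sub_zero] at hn
  exact absurd (hlt n) (not_lt.mpr hn.le)

/-- Potter's bound in additive form, obtained by chaining unit steps. -/
theorem exists_forall_abs_sub_le {ℓ : ℝ → ℝ} (hm : Measurable ℓ)
    (h : ∀ u, Tendsto (fun x => ℓ (x + u) - ℓ x) atTop (𝓝 0)) {ε : ℝ} (hε : 0 < ε) :
    ∃ X, ∀ x ≥ X, ∀ y ≥ X, |ℓ y - ℓ x| ≤ ε * (|y - x| + 1) := by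
  obtain ⟨X, hX⟩ := exists_forall_abs_increment_le hm h hε
  have step : ∀ N : ℕ, ∀ x ≥ X, ∀ u : ℝ, 0 ≤ u → u ≤ N + 1 →
      |ℓ (x + u) - ℓ x| ≤ ε * (u + 1) := by
    intro N
    induction N with
    | zero =>
      intro x hx u hu0 hu1
      refine (hX x hx u ⟨hu0, by simpa using hu1⟩).trans ?_
      nlinarith
    | succ N ih =>
      intro x hx u hu0 hu1
      push_cast at hu1
      rcases le_or_gt u 1 with hu | hu
      · refine (hX x hx u ⟨hu0, hu⟩).trans ?_
        nlinarith
      · have h1 := ih (x + 1) (by linarith) (u - 1) (by linarith) (by linarith)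
        have h2 := hX x hx 1 ⟨by norm_num, le_rfl⟩
        rw [show x + 1 + (u - 1) = x + u by ring] at h1
        have h3 := abs_sub_le (ℓ (x + u)) (ℓ (x + 1)) (ℓ x)
        linarith
  have main : ∀ x ≥ X, ∀ y ≥ x, |ℓ y - ℓ x| ≤ ε * (|y - x| + 1) := by
    intro x hx y hy
    have h1 := step ⌊y - x⌋₊ x hx (y - x) (by linarith) (Nat.lt_floor_add_one _).le
    rwa [add_sub_cancel, ← abs_of_nonneg (sub_nonneg.2 hy)] at h1
  refine ⟨X, fun x hx y hy => ?_⟩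
  rcases le_total x y with hxy | hxy
  · exact main x hx y hxy
  · rw [abs_sub_comm, abs_sub_comm y x]
    exact main y hy x hxy

/-- `g` is measurable, nonnegative and regularly varying at infinity with exponent `-α`. -/
structure IsRegVarying (g : ℝ → ℝ) (α : ℝ) : Prop where
  measurable : Measurable g
  nonneg : ∀ r, 0 ≤ g r
  tail : ∀ r : ℝ, 0 < r → Tendsto (fun t : ℝ => g (t * r) / g t) atTop (𝓝 (r ^ (-α)))

namespace IsRegVarying

variable {g : ℝ → ℝ} {α : ℝ}

theorem eventually_pos (hg : IsRegVarying g α) : ∀ᶠ t in atTop, 0 < g t := by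
  have h1 := (hg.tail 1 one_pos).eventually (lt_mem_nhds (Real.rpow_pos_of_pos one_pos _))
  filter_upwards [h1] with t ht
  refine lt_of_le_of_ne (hg.nonneg t) fun h0 => ?_
  rw [← h0, div_zero] at ht
  exact lt_irrefl _ ht

/-- Potter's bound in logarithmic form. -/
theorem potter (hg : IsRegVarying g α) {ε : ℝ} (hε : 0 < ε) :
    ∃ T > 0, ∀ r ≥ T, 0 < g r ∧ ∀ s ≥ T,
      |Real.log (g s) - Real.log (g r) + α * (Real.log s - Real.log r)| ≤
        ε * (|Real.log s - Real.log r| + 1) := by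
  let ℓ : ℝ → ℝ := fun x => Real.log (g (Real.exp x)) + α * x
  have hm : Measurable ℓ :=
    ((Real.measurable_log.comp (hg.measurable.comp Real.measurable_exp))).add
      (measurable_id.const_mul α)
  have hl : ∀ u, Tendsto (fun x => ℓ (x + u) - ℓ x) atTop (𝓝 0) := by
    intro u
    have h1 := (hg.tail _ (Real.exp_pos u)).comp Real.tendsto_exp_atTop
    have h2 := h1.log (Real.rpow_pos_of_pos (Real.exp_pos u) _).ne'
    rw [Real.log_rpow (Real.exp_pos u), Real.log_exp] at h2
    have h3 := h2.add_const (α * u)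
    rw [show -α * u + α * u = 0 by ring] at h3
    refine h3.congr' ?_
    have hp := Real.tendsto_exp_atTop.eventually hg.eventually_pos
    have hp' := (tendsto_atTop_add_const_right atTop u tendsto_id).eventually hp
    filter_upwards [hp, hp'] with x hx hxu
    simp only [id] at hxu
    simp only [Function.comp, ← Real.exp_add, ℓ]
    rw [Real.log_div hxu.ne' hx.ne']
    ring
  obtain ⟨X, hX⟩ := exists_forall_abs_sub_le hm hl hε
  obtain ⟨T, hT⟩ := eventually_atTop.1 hg.eventually_pos
  refine ⟨max T (Real.exp X), lt_max_of_lt_right (Real.exp_pos _), fun r hr => ?_⟩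
  have hr0 : 0 < r := (Real.exp_pos X).trans_le ((le_max_right _ _).trans hr)
  refine ⟨hT r ((le_max_left _ _).trans hr), fun s hs => ?_⟩
  have hs0 : 0 < s := (Real.exp_pos X).trans_le ((le_max_right _ _).trans hs)
  have h1 := hX (Real.log r) ((Real.le_log_iff_exp_le hr0).2 ((le_max_right _ _).trans hr))
    (Real.log s) ((Real.le_log_iff_exp_le hs0).2 ((le_max_right _ _).trans hs))
  simp only [ℓ, Real.exp_log hr0, Real.exp_log hs0] at h1
  convert h1 using 2
  ring

/-- The convergence defining regular variation, along moving ratios. -/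
theorem tendsto_div (hg : IsRegVarying g α) {r s : ℕ → ℝ} {c : ℝ} (hc : 0 < c)
    (hr : Tendsto r atTop atTop) (hrs : Tendsto (fun n => s n / r n) atTop (𝓝 c)) :
    Tendsto (fun n => g (s n) / g (r n)) atTop (𝓝 (c ^ (-α))) := by
  have hs : Tendsto s atTop atTop := by
    refine (hr.atTop_mul_pos hc hrs).congr' ?_
    filter_upwards [hr.eventually_gt_atTop 0] with n hn
    field_simp
  have hlog : Tendsto (fun n => Real.log (s n) - Real.log (r n)) atTop (𝓝 (Real.log c)) := by
    refine (hrs.log hc.ne').congr' ?_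
    filter_upwards [hr.eventually_gt_atTop 0, hs.eventually_gt_atTop 0] with n hn hn'
    rw [Real.log_div hn'.ne' hn.ne']
  have hz : Tendsto (fun n => Real.log (g (s n)) - Real.log (g (r n)) +
      α * (Real.log (s n) - Real.log (r n))) atTop (𝓝 0) := by
    rw [Metric.tendsto_nhds]
    intro ε hε
    have hδ : 0 < ε / (|Real.log c| + 2) := by positivity
    obtain ⟨T, -, hT⟩ := hg.potter hδ
    have hb : ∀ᶠ n in atTop, |Real.log (s n) - Real.log (r n)| < |Real.log c| + 1 :=
      hlog.abs.eventually (gt_mem_nhds (lt_add_one _))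
    filter_upwards [hr.eventually_ge_atTop T, hs.eventually_ge_atTop T, hb] with n h1 h2 h3
    rw [Real.dist_eq, sub_zero]
    refine ((hT _ h1).2 _ h2).trans_lt ?_
    calc _ < ε / (|Real.log c| + 2) * (|Real.log c| + 1 + 1) := by gcongr
      _ = ε := by field_simp; ring
  have h4 := (hz.sub (hlog.const_mul α)).rexp
  rw [show Real.exp (0 - α * Real.log c) = c ^ (-α) by
    rw [Real.rpow_def_of_pos hc]; congr 1; ring] at h4
  refine h4.congr' ?_
  filter_upwards [hr.eventually hg.eventually_pos, hs.eventually hg.eventually_pos] with n h1 h2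
  rw [add_sub_cancel_right, Real.exp_sub, Real.exp_log h1, Real.exp_log h2]

/-- Potter's bound for ratios of arguments bounded away from `0`. -/
theorem exists_div_le (hg : IsRegVarying g α) {ε c : ℝ} (hε : 0 < ε) (hc : 0 < c) :
    ∃ C > 0, ∃ T > 0, ∀ r ≥ T, 0 < g r ∧ ∀ s, c * r ≤ s → g s / g r ≤ C * (s / r) ^ (-α + ε) := by
  obtain ⟨T, hT0, hT⟩ := hg.potter hε
  refine ⟨Real.exp (ε * (2 * |Real.log c| + 1)), Real.exp_pos _, max T (T / c),
    lt_max_of_lt_left hT0, fun r hr => ?_⟩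
  have hr0 : 0 < r := hT0.trans_le ((le_max_left _ _).trans hr)
  obtain ⟨hgr, hr2⟩ := hT r ((le_max_left _ _).trans hr)
  refine ⟨hgr, fun s hs => ?_⟩
  have hsT : T ≤ s := by
    refine le_trans ?_ hs
    have := (le_max_right T (T / c)).trans hr
    rwa [div_le_iff₀' hc] at this
  have hs0 : 0 < s := hT0.trans_le hsT
  have h1 := hr2 s hsT
  have hgs := (hT s hsT).1
  have hw : Real.log c ≤ Real.log s - Real.log r := by
    rw [← Real.log_div hs0.ne' hr0.ne']
    exact Real.log_le_log hc ((le_div_iff₀ hr0).2 hs)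
  have hw2 : |Real.log s - Real.log r| ≤ (Real.log s - Real.log r) + 2 * |Real.log c| := by
    have := neg_abs_le (Real.log c)
    have := abs_nonneg (Real.log c)
    exact abs_le.2 ⟨by linarith, by linarith⟩
  rw [Real.rpow_def_of_pos (div_pos hs0 hr0), ← Real.exp_add, Real.log_div hs0.ne' hr0.ne',
    ← Real.log_le_iff_le_exp (div_pos hgs hgr), Real.log_div hgs.ne' hgr.ne']
  have h2 := (abs_le.1 h1).2
  nlinarith

end IsRegVarying

/-! ### Product measures with densities -/

theorem lintegral_fin_prod_pi {E : Type*} [MeasurableSpace E] (ν : Measure E) [SigmaFinite ν] :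
    ∀ {l : ℕ} (w : Fin l → E → ℝ≥0∞), (∀ i, Measurable (w i)) →
      ∫⁻ x, ∏ i, w i (x i) ∂(Measure.pi fun _ : Fin l => ν) = ∏ i, ∫⁻ x, w i x ∂ν
  | 0, w, _ => by simp
  | l + 1, w, hw => by
    rw [← ((measurePreserving_piFinSuccAbove (fun _ : Fin (l + 1) => ν) 0).symm).lintegral_comp
      (by fun_prop)]
    simp_rw [Fin.prod_univ_succ]
    simp only [MeasurableEquiv.piFinSuccAbove_symm_apply, Fin.insertNthEquiv_zero, Fin.consEquiv_apply,
      Fin.cons_zero, Fin.cons_succ]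
    rw [← lintegral_fin_prod_pi ν (fun i => w i.succ) fun i => hw _]
    exact lintegral_prod_mul (μ := ν) (ν := Measure.pi fun _ : Fin l => ν)
      (g := fun y : Fin l → E => ∏ i, w i.succ (y i))
      (hw 0).aemeasurable (Finset.measurable_fun_prod _ fun i _ =>
        (hw _).comp (measurable_pi_apply i)).aemeasurable

theorem lintegral_prod_pi {E ι : Type*} [Fintype ι] [MeasurableSpace E] (ν : Measure E)
    [SigmaFinite ν] (w : ι → E → ℝ≥0∞) (hw : ∀ i, Measurable (w i)) :
    ∫⁻ x, ∏ i, w i (x i) ∂(Measure.pi fun _ : ι => ν) = ∏ i, ∫⁻ x, w i x ∂ν := by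
  let e := Fintype.equivFin ι
  have h1 := lintegral_fin_prod_pi ν (fun j => w (e.symm j)) fun j => hw _
  rw [Equiv.prod_comp e.symm (fun i => ∫⁻ x, w i x ∂ν)] at h1
  rw [← h1, ← (measurePreserving_arrowCongr' (fun _ : ι => ν) (fun _ => ν) e
    (MeasurableEquiv.refl E) fun _ => MeasurePreserving.id ν).lintegral_comp (by fun_prop)]
  refine lintegral_congr fun x => ?_
  rw [← Equiv.prod_comp e.symm (fun i => w i (x i))]
  rfl

theorem pi_withDensity {E ι : Type*} [Fintype ι] [MeasurableSpace E] (ν : Measure E)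
    [SigmaFinite ν] {w : E → ℝ≥0∞} (hw : Measurable w) [SigmaFinite (ν.withDensity w)] :
    Measure.pi (fun _ : ι => ν.withDensity w) =
      (Measure.pi fun _ : ι => ν).withDensity fun x => ∏ i, w (x i) := by
  refine Measure.pi_eq fun s hs => ?_
  rw [withDensity_apply _ (MeasurableSet.univ_pi hs),
    ← lintegral_indicator (MeasurableSet.univ_pi hs)]
  simp_rw [withDensity_apply _ (hs _), ← lintegral_indicator (hs _)]
  rw [← lintegral_prod_pi ν (fun i => (s i).indicator w) fun i => hw.indicator (hs i)]
  refine lintegral_congr fun x => ?_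
  by_cases hx : x ∈ Set.univ.pi s
  · rw [Set.indicator_of_mem hx]
    exact Finset.prod_congr rfl fun i _ => (Set.indicator_of_mem (hx i trivial) _).symm
  · rw [Set.indicator_of_notMem hx]
    simp only [Set.mem_univ_pi, not_forall] at hx
    obtain ⟨i, hi⟩ := hx
    exact (Finset.prod_eq_zero (Finset.mem_univ i) (Set.indicator_of_notMem hi _)).symm

theorem volume_setOf_apply_eq_apply {d : ℕ} (hd : 1 ≤ d) {ι : Type*} [Fintype ι] {i j : ι}
    (hij : i ≠ j) :
    (volume : Measure (ι → EuclideanSpace ℝ (Fin d))) {x | x i = x j} = 0 := by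
  let p : Submodule ℝ (ι → EuclideanSpace ℝ (Fin d)) :=
    { carrier := {x | x i = x j}
      add_mem' := fun {a b} ha hb => by
        simp only [Set.mem_ofPred_eq, Pi.add_apply] at ha hb ⊢; rw [ha, hb]
      zero_mem' := rfl
      smul_mem' := fun c a ha => by
        simp only [Set.mem_ofPred_eq, Pi.smul_apply] at ha ⊢; rw [ha] }
  refine Measure.addHaar_submodule volume p fun htop => ?_
  classical
  let v : EuclideanSpace ℝ (Fin d) := EuclideanSpace.single ⟨0, hd⟩ 1
  have hv : (Function.update 0 i v : ι → EuclideanSpace ℝ (Fin d)) ∈ p := by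
    rw [htop]; trivial
  have h1 : (Function.update 0 i v : ι → EuclideanSpace ℝ (Fin d)) i =
    (Function.update 0 i v : ι → EuclideanSpace ℝ (Fin d)) j := hv
  rw [Function.update_self, Function.update_of_ne hij.symm] at h1
  have h2 : v ⟨0, hd⟩ = (0 : EuclideanSpace ℝ (Fin d)) ⟨0, hd⟩ := by rw [h1]; rfl
  simp [v] at h2

/-! ### Factorial moment measures of a Poisson process -/

theorem lintegral_poissonMeasure (r : ℝ≥0) : ∫⁻ n : ℕ, (n : ℝ≥0∞) ∂(poissonMeasure r) = r := by
  have h1 : ∑' n, (poissonMeasure r) {n} = 1 := by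
    rw [← measure_univ (μ := poissonMeasure r)]
    have := lintegral_countable' (μ := poissonMeasure r) (fun _ : ℕ => (1 : ℝ≥0∞))
    simpa using this.symm
  rw [lintegral_countable', tsum_eq_zero_add' ENNReal.summable]
  simp only [Nat.cast_zero, zero_mul, zero_add]
  have h2 : ∀ n : ℕ, ((n + 1 : ℕ) : ℝ≥0∞) * (poissonMeasure r) {n + 1} =
      r * (poissonMeasure r) {n} := by
    intro n
    rw [poissonMeasure_singleton, poissonMeasure_singleton, ← ENNReal.ofReal_natCast,
      ← ENNReal.ofReal_mul (by positivity), ← ENNReal.ofReal_coe_nnreal,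
      ← ENNReal.ofReal_mul (by positivity)]
    congr 1
    rw [Nat.factorial_succ]
    push_cast
    field_simp
    ring
  simp_rw [h2]
  rw [ENNReal.tsum_mul_left, h1, mul_one]

section FactorialMeasure

variable {E : Type*}

open Classical in
/-- The `ι`-tuples of pairwise distinct points of the finite set `s`. -/
def injTuples (ι : Type*) [Fintype ι] (s : Finset E) : Finset (ι → E) :=
  (Fintype.piFinset fun _ => s).filter Function.Injective

theorem mem_injTuples {ι : Type*} [Fintype ι] {s : Finset E} {x : ι → E} :
    x ∈ injTuples ι s ↔ (∀ i, x i ∈ s) ∧ Function.Injective x := by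
  simp [injTuples]

variable [MeasurableSpace E]

/-- The factorial measure of the finite set `s`: one unit of mass at every `ι`-tuple of pairwise
distinct points of `s`. -/
def factorialMeasure (ι : Type*) [Fintype ι] (s : Finset E) : Measure (ι → E) :=
  ∑ x ∈ injTuples ι s, Measure.dirac x

theorem lintegral_factorialMeasure {ι : Type*} [Fintype ι] (s : Finset E) {G : (ι → E) → ℝ≥0∞}
    (hG : Measurable G) : ∫⁻ x, G x ∂(factorialMeasure ι s) = ∑ x ∈ injTuples ι s, G x := by
  rw [factorialMeasure, lintegral_finsetSum_measure]
  exact Finset.sum_congr rfl fun x _ => lintegral_dirac' x hG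

instance {ι : Type*} [Fintype ι] (s : Finset E) : IsFiniteMeasure (factorialMeasure ι s) := by
  unfold factorialMeasure; infer_instance

theorem factorialMeasure_apply {ι : Type*} [Fintype ι] (s : Finset E) {A : Set (ι → E)}
    (hA : MeasurableSet A) [DecidablePred (· ∈ A)] :
    factorialMeasure ι s A = (((injTuples ι s).filter (· ∈ A)).card : ℝ≥0∞) := by
  rw [← lintegral_indicator_one hA, lintegral_factorialMeasure s (measurable_one.indicator hA),
    Finset.card_filter, Nat.cast_sum]
  refine Finset.sum_congr rfl fun x _ => ?_
  by_cases hx : x ∈ A <;> simp [hx]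

theorem factorialMeasure_setOf_not_injective {ι : Type*} [Fintype ι] (s : Finset E)
    (hA : MeasurableSet {x : ι → E | ¬ Function.Injective x}) :
    factorialMeasure ι s {x | ¬ Function.Injective x} = 0 := by
  classical
  rw [factorialMeasure_apply s hA, Nat.cast_eq_zero, Finset.card_eq_zero]
  refine Finset.filter_eq_empty_iff.2 fun x hx => ?_
  simpa using (mem_injTuples.1 hx).2

/-- On a box with pairwise disjoint sides every tuple is injective, so the factorial measure is a
product of counts. -/
theorem factorialMeasure_pi {ι : Type*} [Fintype ι] (s : Finset E) {B : ι → Set E}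
    (hB : ∀ i, MeasurableSet (B i)) (hdisj : ∀ i j, i ≠ j → Disjoint (B i) (B j)) :
    factorialMeasure ι s (Set.univ.pi B) = ∏ i, (count s (B i) : ℝ≥0∞) := by
  classical
  rw [factorialMeasure_apply s (MeasurableSet.univ_pi hB)]
  have h1 : (injTuples ι s).filter (· ∈ Set.univ.pi B) =
      Fintype.piFinset fun i => s.filter (· ∈ B i) := by
    ext x
    simp only [Finset.mem_filter, mem_injTuples, Set.mem_univ_pi, Fintype.mem_piFinset]
    refine ⟨fun h i => ⟨h.1.1 i, h.2 i⟩, fun h => ⟨⟨fun i => (h i).1, fun i j hij => ?_⟩,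
      fun i => (h i).2⟩⟩
    by_contra hne
    exact Set.disjoint_left.1 (hdisj i j hne) (h i).2 (hij ▸ (h j).2)
  rw [h1, Fintype.card_piFinset, Nat.cast_prod]
  refine Finset.prod_congr rfl fun i _ => ?_
  rw [count, ← Set.ncard_coe_finset]
  congr 2
  ext x
  simp

variable {Ω : Type*} [MeasurableSpace Ω] {N : Ω → Finset E} {Λ : Measure E} {μ : Measure Ω}

theorem IsPoissonProcess.lintegral_count (hN : IsPoissonProcess N Λ μ) {B : Set E}
    (hB : MeasurableSet B) : ∫⁻ ω, (count (N ω) B : ℝ≥0∞) ∂μ = Λ B := by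
  have h1 := lintegral_map (μ := μ) (f := fun n : ℕ => (n : ℝ≥0∞)) (measurable_of_countable _)
    (hN.measurable_count B hB)
  rw [← h1, hN.law_count B hB, lintegral_poissonMeasure, ENNReal.coe_toNNReal]
  exact ((measure_mono (Set.subset_univ B)).trans_lt hN.finite).ne

theorem IsPoissonProcess.lintegral_factorialMeasure_pi (hN : IsPoissonProcess N Λ μ)
    {ι : Type*} [Fintype ι] {B : ι → Set E}
    (hB : ∀ i, MeasurableSet (B i)) (hdisj : ∀ i j, i ≠ j → Disjoint (B i) (B j)) :
    ∫⁻ ω, factorialMeasure ι (N ω) (Set.univ.pi B) ∂μ = ∏ i, Λ (B i) := by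
  simp_rw [factorialMeasure_pi _ hB hdisj]
  let e := Fintype.equivFin ι
  have h1 := hN.indep_count (Fintype.card ι) (fun j => B (e.symm j)) (fun j => hB _)
    fun i j hij => hdisj _ _ (e.symm.injective.ne hij)
  have h2 := lintegral_prod_eq_prod_lintegral_of_indepFun Finset.univ _
    (h1.comp (fun _ (n : ℕ) => (n : ℝ≥0∞)) fun _ => measurable_of_countable _)
    (fun j => (measurable_of_countable (fun n : ℕ => (n : ℝ≥0∞))).comp
      (hN.measurable_count _ (hB (e.symm j))))
  simp only [Function.comp, hN.lintegral_count (hB _)] at h2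
  rw [Equiv.prod_comp e.symm (fun i => Λ (B i))] at h2
  rw [← h2]
  refine lintegral_congr fun ω => ?_
  rw [Equiv.prod_comp e.symm (fun i => (count (N ω) (B i) : ℝ≥0∞))]

/-- Countably many boxes with pairwise disjoint sides cover the injective tuples. -/
theorem exists_seq_disjoint_box (ι : Type*) [Fintype ι] [TopologicalSpace E] [BorelSpace E]
    [T2Space E] [SecondCountableTopology E] :
    ∃ t : ℕ → Set (ι → E), (∀ n, t n = ∅ ∨ ∃ B : ι → Set E, (∀ i, MeasurableSet (B i)) ∧
      (∀ i j, i ≠ j → Disjoint (B i) (B j)) ∧ t n = Set.univ.pi B) ∧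
      ∀ x, Function.Injective x → ∃ n, x ∈ t n := by
  let b := TopologicalSpace.countableBasis E
  let T : Set (Set (ι → E)) := (fun B : ι → Set E => Set.univ.pi B) ''
    {B | (∀ i, B i ∈ b) ∧ ∀ i j, i ≠ j → Disjoint (B i) (B j)}
  have hT : (insert ∅ T).Countable := by
    refine Set.Countable.insert _ (Set.Countable.image ?_ _)
    refine (Set.countable_pi (s := fun _ : ι => b)
      fun _ => TopologicalSpace.countable_countableBasis E).mono fun B hB => hB.1
  obtain ⟨t, ht⟩ := hT.exists_eq_range (Set.insert_nonempty _ _)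
  refine ⟨t, fun n => ?_, fun x hx => ?_⟩
  · have : t n ∈ insert ∅ T := ht ▸ Set.mem_range_self n
    rcases this with h | ⟨B, hB, hBt⟩
    · exact Or.inl h
    · exact Or.inr ⟨B, fun i => ((TopologicalSpace.isBasis_countableBasis E).isOpen
        (hB.1 i)).measurableSet, hB.2, hBt.symm⟩
  · obtain ⟨U, hU, hdisj⟩ := (Set.finite_range x).t2_separation
    have hex : ∀ i, ∃ V ∈ b, x i ∈ V ∧ V ⊆ U (x i) := fun i =>
      (TopologicalSpace.isBasis_countableBasis E).exists_subset_of_mem_open (hU _).1 (hU _).2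
    choose V hVb hxV hVU using hex
    have hV : Set.univ.pi V ∈ insert ∅ T := by
      refine Or.inr ⟨V, ⟨hVb, fun i j hij => ?_⟩, rfl⟩
      exact (hdisj (Set.mem_range_self i) (Set.mem_range_self j) (hx.ne hij)).mono (hVU i) (hVU j)
    rw [ht] at hV
    obtain ⟨n, hn⟩ := hV
    exact ⟨n, hn ▸ fun i _ => hxV i⟩

theorem measurableSet_setOf_not_injective (ι : Type*) [Fintype ι] [MeasurableEq E] :
    MeasurableSet {x : ι → E | ¬ Function.Injective x} := by
  have : {x : ι → E | ¬ Function.Injective x} =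
      ⋃ i, ⋃ j, ⋃ (_ : i ≠ j), {x : ι → E | x i = x j} := by
    ext x
    simp only [Function.Injective, not_forall, Set.mem_ofPred_eq, Set.mem_iUnion, exists_prop]
    exact ⟨fun ⟨i, j, h, h'⟩ => ⟨i, j, h', h⟩, fun ⟨i, j, h, h'⟩ => ⟨i, j, h', h⟩⟩
  rw [this]
  exact MeasurableSet.iUnion fun i => MeasurableSet.iUnion fun j => MeasurableSet.iUnion fun _ =>
    measurableSet_eq_fun (measurable_pi_apply i) (measurable_pi_apply j)

variable [TopologicalSpace E] [BorelSpace E] [T2Space E] [SecondCountableTopology E]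

/-- Off the diagonals the space is covered by boxes with pairwise disjoint sides, where the factorial
measure is a product of counts; hence measurability of the counts suffices. -/
theorem IsPoissonProcess.measurable_factorialMeasure (hN : IsPoissonProcess N Λ μ)
    (ι : Type*) [Fintype ι] : Measurable fun ω => factorialMeasure ι (N ω) := by
  obtain ⟨t, ht, htc⟩ := exists_seq_disjoint_box (E := E) ι
  have htm : ∀ n, MeasurableSet (t n) := by
    intro n
    rcases ht n with h | ⟨B, hB, -, h⟩
    · rw [h]; exact MeasurableSet.empty
    · rw [h]; exact MeasurableSet.univ_pi hB
  have hprod : ∀ B : ι → Set E, (∀ i, MeasurableSet (B i)) →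
      (∀ i j, i ≠ j → Disjoint (B i) (B j)) →
      Measurable fun ω => factorialMeasure ι (N ω) (Set.univ.pi B) := by
    intro B hB hdisj
    simp_rw [factorialMeasure_pi _ hB hdisj]
    exact Finset.measurable_fun_prod _ fun i _ =>
      (measurable_of_countable (fun n : ℕ => (n : ℝ≥0∞))).comp (hN.measurable_count _ (hB i))
  have hrect : ∀ n, ∀ A : ι → Set E, (∀ i, MeasurableSet (A i)) →
      Measurable fun ω => factorialMeasure ι (N ω) (Set.univ.pi A ∩ t n) := by
    intro n A hA
    rcases ht n with h | ⟨B, hB, hdisj, h⟩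
    · simp [h]
    · rw [h, ← Set.pi_inter_distrib]
      exact hprod _ (fun i => (hA i).inter (hB i)) fun i j hij =>
        (hdisj i j hij).mono Set.inter_subset_right Set.inter_subset_right
  have hres : ∀ n, Measurable fun ω => (factorialMeasure ι (N ω)).restrict (t n) := by
    intro n
    refine Measurable.measure_of_isPiSystem generateFrom_pi.symm
      isPiSystem_pi ?_ ?_
    · rintro _ ⟨A, hA, rfl⟩
      have hA' : ∀ i, MeasurableSet (A i) := fun i => hA i trivial
      simp_rw [Measure.restrict_apply (MeasurableSet.univ_pi hA')]
      exact hrect n A hA'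
    · simp_rw [Measure.restrict_apply MeasurableSet.univ]
      have := hrect n (fun _ => Set.univ) fun _ => MeasurableSet.univ
      rwa [Set.pi_univ] at this
  rw [Measure.measurable_measure]
  intro A hA
  have hcov : ∀ ω, factorialMeasure ι (N ω) A =
      ∑' n, factorialMeasure ι (N ω) (A ∩ disjointed t n) := by
    intro ω
    rw [← measure_iUnion]
    · rw [← Set.inter_iUnion, iUnion_disjointed]
      refine (measure_inter_conull ?_).symm
      refine measure_mono_null (fun x hx => ?_)
        (factorialMeasure_setOf_not_injective (N ω) (measurableSet_setOf_not_injective ι))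
      intro hinj
      exact hx (Set.mem_iUnion.2 (htc x hinj))
    · exact fun i j hij => (disjoint_disjointed t hij).mono Set.inter_subset_right
        Set.inter_subset_right
    · exact fun n => hA.inter (MeasurableSet.disjointed htm n)
  simp_rw [hcov]
  refine Measurable.tsum fun n => ?_
  have h1 := Measure.measurable_measure.1 (hres n) _ (hA.inter (MeasurableSet.disjointed htm n))
  simp_rw [Measure.restrict_apply (hA.inter (MeasurableSet.disjointed htm n)), Set.inter_assoc,
    Set.inter_eq_left.2 (disjointed_subset t n)] at h1
  exact h1

/-- The factorial moment measures of a Poisson process are the powers of its intensity measure,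
provided these do not charge the diagonals. Both sides vanish on the diagonals, and by independence
of counts they agree on the boxes with pairwise disjoint sides covering the rest. -/
theorem IsPoissonProcess.bind_factorialMeasure (hN : IsPoissonProcess N Λ μ)
    (ι : Type*) [Fintype ι] [SigmaFinite Λ]
    (hdiag : ∀ i j : ι, i ≠ j → Measure.pi (fun _ : ι => Λ) {x | x i = x j} = 0) :
    μ.bind (fun ω => factorialMeasure ι (N ω)) = Measure.pi fun _ => Λ := by
  have : IsFiniteMeasure Λ := ⟨hN.finite⟩
  obtain ⟨t, ht, htc⟩ := exists_seq_disjoint_box (E := E) ι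
  have hM := (hN.measurable_factorialMeasure ι).aemeasurable (μ := μ)
  have hbox : ∀ B : ι → Set E, (∀ i, MeasurableSet (B i)) →
      (∀ i j, i ≠ j → Disjoint (B i) (B j)) →
      μ.bind (fun ω => factorialMeasure ι (N ω)) (Set.univ.pi B) =
        Measure.pi (fun _ => Λ) (Set.univ.pi B) := by
    intro B hB hdisj
    rw [Measure.bind_apply (MeasurableSet.univ_pi hB) hM,
      hN.lintegral_factorialMeasure_pi hB hdisj, Measure.pi_pi]
  have hrect : ∀ n, ∀ A : ι → Set E, (∀ i, MeasurableSet (A i)) →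
      μ.bind (fun ω => factorialMeasure ι (N ω)) (Set.univ.pi A ∩ t n) =
        Measure.pi (fun _ => Λ) (Set.univ.pi A ∩ t n) := by
    intro n A hA
    rcases ht n with h | ⟨B, hB, hdisj, h⟩
    · simp [h]
    · rw [h, ← Set.pi_inter_distrib]
      exact hbox _ (fun i => (hA i).inter (hB i)) fun i j hij =>
        (hdisj i j hij).mono Set.inter_subset_right Set.inter_subset_right
  have hfull : ∀ n, μ.bind (fun ω => factorialMeasure ι (N ω)) (t n) =
      Measure.pi (fun _ => Λ) (t n) := by
    intro n
    have := hrect n (fun _ => Set.univ) fun _ => MeasurableSet.univ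
    rwa [Set.pi_univ, Set.univ_inter] at this
  have hDm := measurableSet_setOf_not_injective (E := E) ι
  have hD1 : μ.bind (fun ω => factorialMeasure ι (N ω)) {x | ¬ Function.Injective x} = 0 := by
    rw [Measure.bind_apply hDm hM]
    simp [factorialMeasure_setOf_not_injective _ hDm]
  have hD2 : Measure.pi (fun _ : ι => Λ) {x | ¬ Function.Injective x} = 0 := by
    have : {x : ι → E | ¬ Function.Injective x} ⊆
        ⋃ i, ⋃ j, ⋃ (_ : i ≠ j), {x : ι → E | x i = x j} := by
      intro x hx
      simp only [Function.Injective, not_forall, Set.mem_ofPred_eq] at hx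
      obtain ⟨i, j, h, h'⟩ := hx
      simp only [Set.mem_iUnion]
      exact ⟨i, j, h', h⟩
    refine measure_mono_null this ?_
    simp only [measure_iUnion_null_iff]
    exact hdiag
  refine Measure.ext_of_generateFrom_of_cover
    (S := Set.pi Set.univ '' Set.pi Set.univ fun _ : ι => {s : Set E | MeasurableSet s})
    (T := insert {x | ¬ Function.Injective x} (Set.range t)) generateFrom_pi.symm
    ((Set.countable_range t).insert _)
    isPiSystem_pi ?_ ?_ ?_ ?_
  · refine Set.eq_univ_of_forall fun x => ?_
    by_cases hx : Function.Injective x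
    · obtain ⟨n, hn⟩ := htc x hx
      exact ⟨t n, Or.inr ⟨n, rfl⟩, hn⟩
    · exact ⟨_, Or.inl rfl, hx⟩
  · rintro _ (rfl | ⟨n, rfl⟩)
    · simp [hD1]
    · rw [hfull]; exact measure_ne_top _ _
  · rintro _ (rfl | ⟨n, rfl⟩) _ ⟨A, hA, rfl⟩
    · rw [measure_inter_null_of_null_right _ hD1, measure_inter_null_of_null_right _ hD2]
    · exact hrect n A fun i => hA i trivial
  · rintro _ (rfl | ⟨n, rfl⟩)
    · rw [hD1, hD2]
    · exact hfull n

/-- The multivariate Mecke formula for functions of the tuple alone: the expected sum of `G` over tuples of distinct points is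
the integral of `G` against the power of the intensity measure. -/
theorem IsPoissonProcess.lintegral_sum_injTuples (hN : IsPoissonProcess N Λ μ)
    {ι : Type*} [Fintype ι] [SigmaFinite Λ]
    (hdiag : ∀ i j : ι, i ≠ j → Measure.pi (fun _ : ι => Λ) {x | x i = x j} = 0)
    {G : (ι → E) → ℝ≥0∞} (hG : Measurable G) :
    ∫⁻ ω, ∑ x ∈ injTuples ι (N ω), G x ∂μ = ∫⁻ x, G x ∂(Measure.pi fun _ => Λ) := by
  rw [← hN.bind_factorialMeasure ι hdiag,
    Measure.lintegral_bind (hN.measurable_factorialMeasure ι).aemeasurable hG.aemeasurable]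
  simp_rw [lintegral_factorialMeasure _ hG]

theorem IsPoissonProcess.measurable_sum_injTuples (hN : IsPoissonProcess N Λ μ)
    {ι : Type*} [Fintype ι] {G : (ι → E) → ℝ≥0∞} (hG : Measurable G) :
    Measurable fun ω => ∑ x ∈ injTuples ι (N ω), G x := by
  simp_rw [← lintegral_factorialMeasure _ hG]
  exact (Measure.measurable_lintegral hG).comp (hN.measurable_factorialMeasure ι)

end FactorialMeasure

/-! ### Sums over subsets and over tuples -/

section Combinatorics

variable {E : Type*}

theorem onSet_of_card_eq {k : ℕ} (F : (Fin k → E) → ℝ) {Y : Finset E} (hY : Y.card = k) :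
    onSet F Y = F fun i => ((Y.equivFinOfCardEq hY).symm i : E) := by
  rw [onSet, dif_pos hY]

/-- Every `k`-point set has `k!` enumerations. -/
theorem sum_injTuples_eq {k : ℕ} {F : (Fin k → E) → ℝ}
    (hF : ∀ (σ : Equiv.Perm (Fin k)) y, F (fun i => y (σ i)) = F y) (s : Finset E) :
    ∑ x ∈ injTuples (Fin k) s, F x = k.factorial * ∑ Y ∈ s.powersetCard k, onSet F Y := by
  classical
  have hmaps : ∀ x ∈ injTuples (Fin k) s, Finset.univ.image x ∈ s.powersetCard k := by
    intro x hx
    rw [mem_injTuples] at hx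
    rw [Finset.mem_powersetCard, Finset.card_image_of_injective _ hx.2, Finset.card_univ,
      Fintype.card_fin]
    refine ⟨fun a ha => ?_, rfl⟩
    obtain ⟨i, -, rfl⟩ := Finset.mem_image.1 ha
    exact hx.1 i
  rw [← Finset.sum_fiberwise_of_maps_to hmaps, Finset.mul_sum]
  refine Finset.sum_congr rfl fun Y hY => ?_
  obtain ⟨hYs, hYk⟩ := Finset.mem_powersetCard.1 hY
  rw [onSet_of_card_eq F hYk]
  set e := (Y.equivFinOfCardEq hYk).symm with he
  have h1 : ∑ x ∈ injTuples (Fin k) s with Finset.univ.image x = Y, F x =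
      ∑ σ : Equiv.Perm (Fin k), F (fun i => (e (σ i) : E)) := by
    symm
    refine Finset.sum_bij (fun σ _ i => (e (σ i) : E)) ?_ ?_ ?_ (fun _ _ => rfl)
    · intro σ _
      rw [Finset.mem_filter, mem_injTuples]
      refine ⟨⟨fun i => hYs (e (σ i)).2, fun i j hij => ?_⟩, ?_⟩
      · exact σ.injective (e.injective (Subtype.ext hij))
      · ext a
        simp only [Finset.mem_image, Finset.mem_univ, true_and]
        refine ⟨fun ⟨i, hi⟩ => hi ▸ (e (σ i)).2, fun ha => ⟨σ.symm (e.symm ⟨a, ha⟩), by simp⟩⟩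
    · intro σ _ τ _ h
      ext i
      have := congrFun h i
      exact congrArg _ (e.injective (Subtype.ext this))
    · intro x hx
      obtain ⟨hx1, rfl⟩ := Finset.mem_filter.1 hx
      have hx2 := (mem_injTuples.1 hx1).2
      let τ : Fin k → Fin k := fun i =>
        e.symm ⟨x i, Finset.mem_image_of_mem x (Finset.mem_univ i)⟩
      have hτ : Function.Injective τ := fun i j hij =>
        hx2 (Subtype.ext_iff.1 (e.symm.injective hij))
      refine ⟨Equiv.ofBijective τ (Finite.injective_iff_bijective.1 hτ), Finset.mem_univ _, ?_⟩
      funext i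
      simp [τ]
  rw [h1, Finset.sum_congr rfl fun σ _ => hF σ fun i => (e i : E), Finset.sum_const,
    Finset.card_univ, Fintype.card_perm, Fintype.card_fin, nsmul_eq_mul]

theorem onSet_zero_or_one {k : ℕ} {h : (Fin k → E) → ℝ} (hh : ∀ y, h y = 0 ∨ h y = 1)
    (Y : Finset E) : onSet h Y = 0 ∨ onSet h Y = 1 := by
  rw [onSet]
  split_ifs
  · exact hh _
  · exact Or.inl rfl

theorem onSet_nonneg {k : ℕ} {h : (Fin k → E) → ℝ} (hh : ∀ y, h y = 0 ∨ h y = 1)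
    (Y : Finset E) : 0 ≤ onSet h Y := by
  rcases onSet_zero_or_one hh Y with h | h <;> simp [h]

open Classical in
/-- A pair of `k`-tuples forms an injective `2k`-tuple exactly when both are injective and they
enumerate disjoint sets. -/
theorem sum_injTuples_sum {k : ℕ} {F : (Fin k → E) → ℝ}
    (hF : ∀ (σ : Equiv.Perm (Fin k)) y, F (fun i => y (σ i)) = F y) (s : Finset E) :
    ∑ z ∈ injTuples (Fin k ⊕ Fin k) s, F (z ∘ Sum.inl) * F (z ∘ Sum.inr) =
      (k.factorial : ℝ) ^ 2 * ∑ Y ∈ s.powersetCard k, ∑ Y' ∈ s.powersetCard k,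
        if Disjoint Y Y' then onSet F Y * onSet F Y' else 0 := by
  have h1 : ∑ z ∈ injTuples (Fin k ⊕ Fin k) s, F (z ∘ Sum.inl) * F (z ∘ Sum.inr) =
      ∑ p ∈ injTuples (Fin k) s ×ˢ injTuples (Fin k) s,
        if Disjoint (Finset.univ.image p.1) (Finset.univ.image p.2) then F p.1 * F p.2 else 0 := by
    rw [← Finset.sum_filter]
    refine Finset.sum_bij' (fun z _ => (z ∘ Sum.inl, z ∘ Sum.inr)) (fun p _ => Sum.elim p.1 p.2)
      ?_ ?_ ?_ ?_ ?_
    · intro z hz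
      rw [mem_injTuples] at hz
      simp only [Finset.mem_filter, Finset.mem_product, mem_injTuples]
      refine ⟨⟨⟨fun i => hz.1 _, hz.2.comp Sum.inl_injective⟩,
        fun i => hz.1 _, hz.2.comp Sum.inr_injective⟩, ?_⟩
      rw [Finset.disjoint_left]
      intro a ha hb
      obtain ⟨i, -, rfl⟩ := Finset.mem_image.1 ha
      obtain ⟨j, -, hj⟩ := Finset.mem_image.1 hb
      exact Sum.inr_ne_inl (hz.2 hj)
    · intro p hp
      simp only [Finset.mem_filter, Finset.mem_product, mem_injTuples] at hp
      rw [mem_injTuples]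
      obtain ⟨⟨⟨h1, h2⟩, h3, h4⟩, h5⟩ := hp
      refine ⟨fun i => by cases i <;> simp [h1, h3], h2.sumElim h4 fun i j hij => ?_⟩
      exact Finset.disjoint_left.1 h5 (Finset.mem_image_of_mem _ (Finset.mem_univ i))
        (hij ▸ Finset.mem_image_of_mem _ (Finset.mem_univ j))
    · intro z _
      exact Sum.elim_comp_inl_inr z
    · intro p _
      simp
    · intro z _
      rfl
  have himg : ∀ (σ : Equiv.Perm (Fin k)) (y : Fin k → E),
      Finset.univ.image (fun i => y (σ i)) = Finset.univ.image y := by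
    intro σ y
    ext a
    simp only [Finset.mem_image, Finset.mem_univ, true_and]
    exact ⟨fun ⟨i, hi⟩ => ⟨σ i, hi⟩, fun ⟨i, hi⟩ => ⟨σ.symm i, by simpa using hi⟩⟩
  have himg' : ∀ {Y : Finset E} (hY : Y.card = k),
      Finset.univ.image (fun i => ((Y.equivFinOfCardEq hY).symm i : E)) = Y := by
    intro Y hY
    ext a
    simp only [Finset.mem_image, Finset.mem_univ, true_and]
    exact ⟨fun ⟨i, hi⟩ => hi ▸ Subtype.prop _, fun ha => ⟨Y.equivFinOfCardEq hY ⟨a, ha⟩, by simp⟩⟩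
  rw [h1, Finset.sum_product]
  have h2 : ∀ x : Fin k → E, ∑ x' ∈ injTuples (Fin k) s,
      (if Disjoint (Finset.univ.image x) (Finset.univ.image x') then F x * F x' else 0) =
      k.factorial * ∑ Y' ∈ s.powersetCard k,
        if Disjoint (Finset.univ.image x) Y' then F x * onSet F Y' else 0 := by
    intro x
    rw [sum_injTuples_eq (F := fun x' : Fin k → E =>
      if Disjoint (Finset.univ.image x) (Finset.univ.image x') then F x * F x' else 0)]
    · congr 1
      refine Finset.sum_congr rfl fun Y' hY' => ?_
      have hc := (Finset.mem_powersetCard.1 hY').2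
      rw [onSet_of_card_eq _ hc, onSet_of_card_eq _ hc, himg' hc]
    · intro σ y
      simp only [himg, hF]
  simp only [h2]
  rw [← Finset.mul_sum, sum_injTuples_eq (F := fun x : Fin k → E => ∑ Y' ∈ s.powersetCard k,
        if Disjoint (Finset.univ.image x) Y' then F x * onSet F Y' else 0)]
  · rw [sq, mul_assoc]
    congr 2
    refine Finset.sum_congr rfl fun Y hY => ?_
    have hc := (Finset.mem_powersetCard.1 hY).2
    rw [onSet_of_card_eq _ hc, onSet_of_card_eq F hc]
    simp only [himg' hc]
  · intro σ y
    simp only [himg, hF]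

/-- The square of a sum over `k`-point sets, split into disjoint pairs and overlapping pairs; the
latter are grouped by their union, which has at most `4 ^ l` such decompositions when it has `l`
points. -/
theorem sq_sum_powersetCard_le [DecidableEq E] {k : ℕ} (s : Finset E) {F G : Finset E → ℝ}
    (hG : ∀ Z, 0 ≤ G Z)
    (hFG : ∀ Y Y' : Finset E, Y.card = k → Y'.card = k → ¬ Disjoint Y Y' →
      F Y * F Y' ≤ G (Y ∪ Y')) :
    (∑ Y ∈ s.powersetCard k, F Y) ^ 2 ≤
      (∑ Y ∈ s.powersetCard k, ∑ Y' ∈ s.powersetCard k, if Disjoint Y Y' then F Y * F Y' else 0) +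
      ∑ l ∈ Finset.Ico k (2 * k), (4 : ℝ) ^ l * ∑ Z ∈ s.powersetCard l, G Z := by
  have h1 : (∑ Y ∈ s.powersetCard k, F Y) ^ 2 =
      (∑ Y ∈ s.powersetCard k, ∑ Y' ∈ s.powersetCard k,
        if Disjoint Y Y' then F Y * F Y' else 0) +
      ∑ p ∈ (s.powersetCard k ×ˢ s.powersetCard k).filter (fun p => ¬ Disjoint p.1 p.2),
        F p.1 * F p.2 := by
    rw [sq, Finset.sum_mul_sum, ← Finset.sum_product', ← Finset.sum_product', ← Finset.sum_filter,
      Finset.sum_filter_add_sum_filter_not]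
  rw [h1]
  gcongr
  let T := s.powerset.filter fun Z => Z.card ∈ Finset.Ico k (2 * k)
  have hmaps : ∀ p ∈ (s.powersetCard k ×ˢ s.powersetCard k).filter (fun p => ¬ Disjoint p.1 p.2),
      p.1 ∪ p.2 ∈ T := by
    intro p hp
    simp only [Finset.mem_filter, Finset.mem_product, Finset.mem_powersetCard] at hp
    obtain ⟨⟨⟨h1, h2⟩, h3, h4⟩, h5⟩ := hp
    simp only [T, Finset.mem_filter, Finset.mem_powerset, Finset.mem_Ico]
    refine ⟨Finset.union_subset h1 h3, ?_, ?_⟩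
    · rw [← h2]; exact Finset.card_le_card Finset.subset_union_left
    · have := Finset.card_union_add_card_inter p.1 p.2
      have h6 : 0 < (p.1 ∩ p.2).card :=
        Finset.card_pos.2 (Finset.not_disjoint_iff_nonempty_inter.1 h5)
      omega
  rw [← Finset.sum_fiberwise_of_maps_to hmaps]
  have hmapsT : ∀ Z ∈ T, Z.card ∈ Finset.Ico k (2 * k) := fun Z hZ => (Finset.mem_filter.1 hZ).2
  calc _ ≤ ∑ Z ∈ T, (4 : ℝ) ^ Z.card * G Z := by
        refine Finset.sum_le_sum fun Z _ => ?_
        refine (Finset.sum_le_card_nsmul _ _ (G Z) ?_).trans ?_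
        · intro p hp
          simp only [Finset.mem_filter, Finset.mem_product, Finset.mem_powersetCard] at hp
          obtain ⟨⟨⟨⟨h1, h2⟩, h3, h4⟩, h5⟩, rfl⟩ := hp
          exact hFG _ _ h2 h4 h5
        · rw [nsmul_eq_mul]
          refine mul_le_mul_of_nonneg_right ?_ (hG Z)
          have hsub : (((s.powersetCard k ×ˢ s.powersetCard k).filter
              (fun p => ¬ Disjoint p.1 p.2)).filter fun p => p.1 ∪ p.2 = Z) ⊆
              Z.powerset ×ˢ Z.powerset := by
            intro p hp
            obtain ⟨-, rfl⟩ := Finset.mem_filter.1 hp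
            rw [Finset.mem_product, Finset.mem_powerset, Finset.mem_powerset]
            exact ⟨Finset.subset_union_left, Finset.subset_union_right⟩
          have := Finset.card_le_card hsub
          rw [Finset.card_product, Finset.card_powerset, ← mul_pow] at this
          exact_mod_cast this
    _ = _ := by
        rw [← Finset.sum_fiberwise_of_maps_to hmapsT]
        refine Finset.sum_congr rfl fun l hl => ?_
        rw [Finset.mul_sum]
        have : T.filter (fun Z => Z.card = l) = s.powersetCard l := by
          ext Z
          simp only [T, Finset.mem_filter, Finset.mem_powerset, Finset.mem_powersetCard]
          exact ⟨fun h => ⟨h.1.1, h.2⟩, fun h => ⟨⟨h.1, h.2 ▸ hl⟩, h.2⟩⟩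
        rw [this]
        refine Finset.sum_congr rfl fun Z hZ => ?_
        rw [(Finset.mem_powersetCard.1 hZ).2]

/-! ### Order statistics -/

/-- An entry of a decreasing list is at least `t` if and only if sufficiently many entries are. The
positivity of `t` accounts for the default value `0` beyond the end of the list. -/
theorem le_getD_iff_le_countP {t : ℝ} (ht : 0 < t) :
    ∀ (l : List ℝ), l.Pairwise (· ≥ ·) → ∀ j : ℕ,
      (t ≤ l.getD j 0 ↔ j + 1 ≤ l.countP (fun x => decide (t ≤ x)))
  | [], _, j => by simp [ht]
  | a :: l, hl, j => by
    obtain ⟨ha, hl⟩ := List.pairwise_cons.1 hl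
    have h0 : a < t → l.countP (fun x => decide (t ≤ x)) = 0 := by
      intro hat
      rw [List.countP_eq_zero]
      intro b hb
      simpa using (ha b hb).trans_lt hat
    rw [List.countP_cons]
    rcases le_or_gt t a with hta | hta
    · cases j with
      | zero => simp [hta]
      | succ j => simp [hta, ← le_getD_iff_le_countP ht l hl j]
    · have hih := le_getD_iff_le_countP ht l hl
      rw [h0 hta]
      cases j with
      | zero => simp [not_le.2 hta]
      | succ j =>
        have := hih j
        rw [h0 hta] at this
        simp only [List.getD_cons_succ, this]
        simp [not_le.2 hta]

variable [Norm E]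

theorem le_orderStat_iff {k : ℕ} (h : (Fin k → E) → ℝ) (s : Finset E) {j : ℕ} (hj : 1 ≤ j) {t : ℝ}
    (ht : 0 < t) :
    t ≤ orderStat h s j ↔
      j ≤ ((s.powersetCard k).filter fun Y => t ≤ onSet h Y * minNorm Y).card := by
  rw [orderStat, le_getD_iff_le_countP ht _ (Multiset.pairwise_sort _ _), Nat.sub_add_cancel hj,
    ← Multiset.coe_countP, Multiset.sort_eq, Multiset.countP_map]
  rfl

/-- The sum of `h(𝒴) φ(min(𝒴))` over the `k`-point subsets of `s`. -/
def layerSum {k : ℕ} (h : (Fin k → E) → ℝ) (φ : ℝ → ℝ) (s : Finset E) : ℝ :=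
  ∑ Y ∈ s.powersetCard k, onSet h Y * φ (minNorm Y)

open Classical in
/-- The `j`-th order statistic is at least `t` if and only if at least `j` admissible sets have
minimum at least `t`. -/
theorem le_orderStat_iff_layerSum {k : ℕ} {h : (Fin k → E) → ℝ} (hh : ∀ y, h y = 0 ∨ h y = 1)
    (s : Finset E) {j : ℕ} (hj : 1 ≤ j) {t : ℝ} (ht : 0 < t) :
    t ≤ orderStat h s j ↔ (j : ℝ) ≤ layerSum h (fun x => if t ≤ x then 1 else 0) s := by
  rw [le_orderStat_iff h s hj ht, Finset.card_filter, layerSum, ← Nat.cast_le (α := ℝ),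
    Nat.cast_sum]
  rw [Finset.sum_congr rfl fun Y _ => ?_]
  rcases onSet_zero_or_one hh Y with h | h
  · simp [h, ht]
  · simp [h]

theorem layerSum_mono {k : ℕ} {h : (Fin k → E) → ℝ} (hh : ∀ y, h y = 0 ∨ h y = 1) {φ ψ : ℝ → ℝ}
    (s : Finset E) (hφ : ∀ Y, φ (minNorm Y) ≤ ψ (minNorm (E := E) Y)) :
    layerSum h φ s ≤ layerSum h ψ s :=
  Finset.sum_le_sum fun Y _ => mul_le_mul_of_nonneg_left (hφ Y) (onSet_nonneg hh Y)

end Combinatorics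

theorem minNorm_nonneg {E : Type*} [SeminormedAddGroup E] (Y : Finset E) : 0 ≤ minNorm Y := by
  rw [minNorm]
  split_ifs with hY
  · exact (Finset.le_inf'_iff hY _).2 fun y _ => norm_nonneg y
  · exact le_rfl

theorem minNorm_le {E : Type*} [Norm E] {Y : Finset E} {y : E} (hy : y ∈ Y) : minNorm Y ≤ ‖y‖ := by
  rw [minNorm, dif_pos ⟨y, hy⟩]
  exact Finset.inf'_le _ hy

theorem exists_minNorm_eq {E : Type*} [Norm E] {Y : Finset E} (hY : Y.Nonempty) :
    ∃ y ∈ Y, minNorm Y = ‖y‖ := by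
  rw [minNorm, dif_pos hY]
  exact Finset.exists_mem_eq_inf' hY _

/-- For `k = 0` both sides take the default value `0`. -/
theorem minNorm_eq_iInf {E : Type*} [Norm E] {k : ℕ} {Y : Finset E} (hY : Y.card = k) :
    minNorm Y = ⨅ i, ‖((Y.equivFinOfCardEq hY).symm i : E)‖ := by
  cases k with
  | zero =>
    rw [Finset.card_eq_zero] at hY
    rw [Real.iInf_of_isEmpty, minNorm, dif_neg (by simp [hY])]
  | succ k =>
    have hne : Y.Nonempty := Finset.card_pos.1 (by omega)
    refine le_antisymm (le_ciInf fun i => minNorm_le (Subtype.prop _)) ?_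
    obtain ⟨y, hy, h⟩ := exists_minNorm_eq hne
    rw [h]
    refine (ciInf_le (Set.finite_range _).bddBelow (Y.equivFinOfCardEq hY ⟨y, hy⟩)).trans ?_
    simp

theorem layerSum_eq_sum_onSet {E : Type*} [Norm E] {k : ℕ} (h : (Fin k → E) → ℝ) (φ : ℝ → ℝ)
    (s : Finset E) :
    layerSum h φ s = ∑ Y ∈ s.powersetCard k, onSet (fun y => h y * φ (⨅ i, ‖y i‖)) Y := by
  refine Finset.sum_congr rfl fun Y hY => ?_
  have hc := (Finset.mem_powersetCard.1 hY).2
  rw [onSet_of_card_eq _ hc, onSet_of_card_eq _ hc, minNorm_eq_iInf hc]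

/-- The estimator is antitone in the cut-off level, so bounds on the order statistic give bounds by
layer sums with a deterministic cut-off. -/
theorem hill_bounds {E : Type*} [SeminormedAddGroup E] {k : ℕ} {h : (Fin k → E) → ℝ}
    (hh : ∀ y, h y = 0 ∨ h y = 1) (m : ℕ) (s : Finset E) {a b : ℝ} (ha : 0 < a)
    (haU : a ≤ orderStat h s (m ^ k)) (hUb : orderStat h s (m ^ k) ≤ b) :
    (1 / (m : ℝ) ^ k) * layerSum h (fun x => Real.log (max (x / b) 1)) s ≤ hill h m s ∧
      hill h m s ≤ (1 / (m : ℝ) ^ k) * layerSum h (fun x => Real.log (max (x / a) 1)) s := by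
  have hU := ha.trans_le haU
  have hill_eq : hill h m s = (1 / (m : ℝ) ^ k) *
      layerSum h (fun x => Real.log (max (x / orderStat h s (m ^ k)) 1)) s := rfl
  rw [hill_eq]
  constructor
  · refine mul_le_mul_of_nonneg_left (layerSum_mono hh s fun Y => ?_) (by positivity)
    have := minNorm_nonneg Y
    exact Real.log_le_log (by positivity) (by gcongr)
  · refine mul_le_mul_of_nonneg_left (layerSum_mono hh s fun Y => ?_) (by positivity)
    have := minNorm_nonneg Y
    exact Real.log_le_log (by positivity) (by gcongr)

/-! ### Radial weights and their integrals -/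

section RadialWeights

/-- A monotone radial weight vanishing below `c`, continuous away from `c`, and growing more slowly
than every power. The estimator involves the weights `𝟙 (c ≤ x)` and `log (max (x / c) 1)`. -/
structure IsLayerWeight (φ : ℝ → ℝ) (c : ℝ) : Prop where
  pos : 0 < c
  mono : Monotone φ
  nonneg : ∀ x, 0 ≤ φ x
  eq_zero : ∀ x < c, φ x = 0
  continuousAt : ∀ x, x ≠ c → ContinuousAt φ x
  growth : ∀ η : ℝ, 0 < η → ∃ C, ∀ x ≥ c, φ x ≤ C * x ^ η

theorem isLayerWeight_indicator {c : ℝ} (hc : 0 < c) :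
    IsLayerWeight (fun x => if c ≤ x then 1 else 0) c where
  pos := hc
  mono := by
    intro x y hxy
    dsimp only
    split_ifs with h1 h2
    · exact le_rfl
    · exact absurd (h1.trans hxy) h2
    · exact zero_le_one
    · exact le_rfl
  nonneg x := by split_ifs <;> norm_num
  eq_zero x hx := if_neg (not_le.2 hx)
  continuousAt x hx := by
    rcases lt_or_gt_of_ne hx with h | h
    · refine (continuousAt_const (y := (0 : ℝ))).congr ?_
      filter_upwards [gt_mem_nhds h] with y hy
      rw [if_neg (not_le.2 hy)]
    · refine (continuousAt_const (y := (1 : ℝ))).congr ?_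
      filter_upwards [lt_mem_nhds h] with y hy
      rw [if_pos hy.le]
  growth η hη := by
    refine ⟨(c ^ η)⁻¹, fun x hx => ?_⟩
    rw [if_pos hx, inv_mul_eq_div, one_le_div (by positivity)]
    exact Real.rpow_le_rpow hc.le hx hη.le

theorem isLayerWeight_log {c : ℝ} (hc : 0 < c) :
    IsLayerWeight (fun x => Real.log (max (x / c) 1)) c where
  pos := hc
  mono x y hxy := Real.log_le_log (by positivity) (by gcongr)
  nonneg x := Real.log_nonneg (le_max_right _ _)
  eq_zero x hx := by rw [max_eq_right ((div_le_one hc).2 hx.le), Real.log_one]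
  continuousAt x _ :=
    ContinuousAt.log (by fun_prop) (ne_of_gt (lt_max_of_lt_right one_pos))
  growth η hη := by
    refine ⟨(c ^ η)⁻¹ / η, fun x hx => ?_⟩
    have hx0 : 0 < x := hc.trans_le hx
    rw [max_eq_left ((one_le_div hc).2 hx)]
    refine (Real.log_le_rpow_div (by positivity) hη).trans_eq ?_
    rw [Real.div_rpow hx0.le hc.le]
    field_simp

namespace IsLayerWeight

variable {φ : ℝ → ℝ} {c : ℝ}

theorem measurable (hφ : IsLayerWeight φ c) : Measurable φ := hφ.mono.measurable

theorem le_of_ne_zero (hφ : IsLayerWeight φ c) {x : ℝ} (hx : φ x ≠ 0) : c ≤ x := by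
  by_contra h
  exact hx (hφ.eq_zero x (not_le.1 h))

/-- The weight controlling products of two overlapping terms. -/
theorem sq_comp_two_mul (hφ : IsLayerWeight φ c) :
    IsLayerWeight (fun x => φ (2 * x) ^ 2) (c / 2) where
  pos := half_pos hφ.pos
  mono x y hxy := by
    have := hφ.nonneg (2 * x)
    have := hφ.mono (show 2 * x ≤ 2 * y by linarith)
    dsimp only
    gcongr
  nonneg x := sq_nonneg _
  eq_zero x hx := by rw [hφ.eq_zero (2 * x) (by linarith), zero_pow two_ne_zero]
  continuousAt x hx := by
    have h1 : ContinuousAt φ (2 * x) := hφ.continuousAt _ fun h => hx (by linarith)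
    exact (ContinuousAt.comp' (f := fun x : ℝ => 2 * x) h1 (by fun_prop)).pow 2
  growth η hη := by
    obtain ⟨C, hC⟩ := hφ.growth (η / 2) (half_pos hη)
    refine ⟨C ^ 2 * 2 ^ η, fun x hx => ?_⟩
    have hx0 : 0 < x := (half_pos hφ.pos).trans_le hx
    have h1 := hC (2 * x) (by linarith)
    calc φ (2 * x) ^ 2 ≤ (C * (2 * x) ^ (η / 2)) ^ 2 := by
          have := hφ.nonneg (2 * x)
          gcongr
      _ = C ^ 2 * 2 ^ η * x ^ η := by
          rw [mul_pow, ← Real.rpow_natCast ((2 * x) ^ (η / 2)), ← Real.rpow_mul (by positivity),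
            mul_assoc, ← Real.mul_rpow (by norm_num) hx0.le]
          norm_num

end IsLayerWeight

theorem integral_indicator_mul_rpow {d : ℕ} (hd : 1 ≤ d) {p c : ℝ} (hp : (d : ℝ) < p)
    (hc : 0 < c) :
    ∫ y in Set.Ioi (0 : ℝ), y ^ (d - 1) • ((if c ≤ y then (1 : ℝ) else 0) * y ^ (-p)) =
      c ^ (-(p - d)) / (p - d) := by
  have h1 : ∫ y in Set.Ioi (0 : ℝ), y ^ (d - 1) • ((if c ≤ y then (1 : ℝ) else 0) * y ^ (-p)) =
      ∫ y in Set.Ioi (0 : ℝ), (Set.Ici c).indicator (fun y => y ^ (-(p - d) - 1)) y := by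
    refine setIntegral_congr_fun measurableSet_Ioi fun y hy => ?_
    have hy : 0 < y := hy
    by_cases h : c ≤ y
    · rw [Set.indicator_of_mem (show y ∈ Set.Ici c from h), if_pos h, one_mul, smul_eq_mul,
        ← Real.rpow_natCast, ← Real.rpow_add hy]
      congr 1
      push_cast [Nat.cast_sub hd]
      ring
    · rw [Set.indicator_of_notMem (show y ∉ Set.Ici c from h), if_neg h, zero_mul, smul_zero]
  rw [h1, setIntegral_indicator measurableSet_Ici,
    Set.inter_eq_right.2 (Set.Ici_subset_Ioi.2 hc), integral_Ici_eq_integral_Ioi,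
    integral_Ioi_rpow_of_lt (by linarith) hc]
  rw [sub_add_cancel, neg_div_neg_eq]

theorem integral_log_mul_rpow {d : ℕ} (hd : 1 ≤ d) {p c : ℝ} (hp : (d : ℝ) < p) (hc : 0 < c) :
    ∫ y in Set.Ioi (0 : ℝ), y ^ (d - 1) • (Real.log (max (y / c) 1) * y ^ (-p)) =
      c ^ (-(p - d)) / (p - d) ^ 2 := by
  have hβ : 0 < p - d := by linarith
  set β := p - d with hβd
  have h1 : ∫ y in Set.Ioi (0 : ℝ), y ^ (d - 1) • (Real.log (max (y / c) 1) * y ^ (-p)) =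
      ∫ y in Set.Ioi (0 : ℝ), (Set.Ioi c).indicator
        (fun y => Real.log (y / c) * y ^ (-β - 1)) y := by
    refine setIntegral_congr_fun measurableSet_Ioi fun y hy => ?_
    have hy : 0 < y := hy
    by_cases h : c < y
    · rw [Set.indicator_of_mem (show y ∈ Set.Ioi c from h),
        max_eq_left ((one_le_div hc).2 h.le), smul_eq_mul, mul_left_comm,
        ← Real.rpow_natCast, ← Real.rpow_add hy]
      congr 2
      push_cast [Nat.cast_sub hd]
      rw [hβd]
      ring
    · rw [Set.indicator_of_notMem (show y ∉ Set.Ioi c from h),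
        max_eq_right ((div_le_one hc).2 (not_lt.1 h)), Real.log_one, zero_mul, smul_zero]
  rw [h1, setIntegral_indicator measurableSet_Ioi,
    Set.inter_eq_right.2 (Set.Ioi_subset_Ioi hc.le)]
  -- an explicit antiderivative
  have hderiv : ∀ y ∈ Set.Ici c, HasDerivAt
      (fun y => -(Real.log (y / c) / β + 1 / β ^ 2) * y ^ (-β))
      (Real.log (y / c) * y ^ (-β - 1)) y := by
    intro y hy
    have hy0 : 0 < y := hc.trans_le hy
    have h2 : HasDerivAt (fun y : ℝ => Real.log (y / c)) (1 / y) y := by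
      have := ((hasDerivAt_id y).div_const c).log (by positivity)
      convert! this using 1
      simp only [id]
      field_simp
    have h3 := Real.hasDerivAt_rpow_const (p := -β) (Or.inl hy0.ne')
    convert! (((h2.div_const β).add_const (1 / β ^ 2)).neg).mul h3 using 1
    rw [show y ^ (-β) = y ^ (-β - 1) * y by
      rw [← Real.rpow_add_one hy0.ne', sub_add_cancel]]
    simp only [Pi.neg_apply]
    field_simp
    ring
  have hlim : Tendsto (fun y => -(Real.log (y / c) / β + 1 / β ^ 2) * y ^ (-β)) atTop (𝓝 0) := by
    have h2 : Tendsto (fun y : ℝ => Real.log y * y ^ (-β)) atTop (𝓝 0) := by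
      have := (isLittleO_log_rpow_atTop hβ).tendsto_div_nhds_zero
      refine this.congr' ?_
      filter_upwards [eventually_gt_atTop 0] with y hy
      rw [Real.rpow_neg hy.le, div_eq_mul_inv]
    have h3 : Tendsto (fun y : ℝ => y ^ (-β)) atTop (𝓝 0) := tendsto_rpow_neg_atTop hβ
    have h4 := (h2.const_mul (-1 / β)).add (h3.const_mul (Real.log c / β - 1 / β ^ 2))
    rw [mul_zero, mul_zero, add_zero] at h4
    refine h4.congr' ?_
    filter_upwards [eventually_gt_atTop 0] with y hy
    rw [Real.log_div hy.ne' hc.ne']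
    ring
  rw [integral_Ioi_of_hasDerivAt_of_nonneg (hderiv c Set.self_mem_Ici).continuousAt.continuousWithinAt
    (fun y hy => hderiv y (Set.Ioi_subset_Ici_self hy)) (fun y hy => ?_) hlim]
  · rw [div_self hc.ne', Real.log_one]
    ring
  · have hy0 : 0 < y := hc.trans hy
    exact mul_nonneg (Real.log_nonneg ((one_le_div hc).2 (le_of_lt hy))) (by positivity)

variable {d : ℕ}

instance instNontrivialEuclideanSpace [NeZero d] : Nontrivial (EuclideanSpace ℝ (Fin d)) := by
  have : Nonempty (Fin d) := ⟨0⟩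
  infer_instance

theorem integrable_norm_rpow_of_lt [NeZero d] {q c : ℝ} (hq : (d : ℝ) < q) (hc : 0 < c) :
    Integrable fun u : EuclideanSpace ℝ (Fin d) => (if c ≤ ‖u‖ then (1 : ℝ) else 0) * ‖u‖ ^ (-q) := by
  refine (integrable_fun_norm_addHaar volume
    (f := fun y : ℝ => (if c ≤ y then (1 : ℝ) else 0) * y ^ (-q))).2 ?_
  rw [finrank_euclideanSpace_fin]
  by_contra hcon
  have h1 := integral_indicator_mul_rpow (NeZero.one_le (n := d)) hq hc
  rw [integral_undef hcon] at h1
  have h2 : 0 < c ^ (-(q - d)) / (q - d) := div_pos (by positivity) (by linarith)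
  exact h2.ne h1

theorem IsLayerWeight.integrable [NeZero d] {φ : ℝ → ℝ} {c p : ℝ} (hφ : IsLayerWeight φ c)
    (hp : (d : ℝ) < p) :
    Integrable fun u : EuclideanSpace ℝ (Fin d) => φ ‖u‖ * ‖u‖ ^ (-p) := by
  obtain ⟨C, hC⟩ := hφ.growth ((p - d) / 2) (by linarith)
  have h1 := (integrable_norm_rpow_of_lt (d := d) (q := p - (p - d) / 2) (c := c)
    (by linarith) hφ.pos).const_mul C
  refine h1.mono' (Measurable.aestronglyMeasurable ?_) (ae_of_all _ fun u => ?_)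
  · exact (hφ.measurable.comp measurable_norm).mul (by fun_prop)
  · rw [Real.norm_of_nonneg (mul_nonneg (hφ.nonneg _) (by positivity))]
    by_cases hu : c ≤ ‖u‖
    · have hu0 : 0 < ‖u‖ := hφ.pos.trans_le hu
      rw [if_pos hu, one_mul, neg_sub, sub_eq_add_neg, Real.rpow_add hu0, ← mul_assoc]
      exact mul_le_mul_of_nonneg_right (hC _ hu) (by positivity)
    · rw [hφ.eq_zero _ (not_le.1 hu), if_neg hu]
      simp

/-- The weight integral `∫ φ(|u|) |u|^{-p} du`. -/
def radialIntegral (d : ℕ) (p : ℝ) (φ : ℝ → ℝ) : ℝ :=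
  ∫ u : EuclideanSpace ℝ (Fin d), φ ‖u‖ * ‖u‖ ^ (-p)

theorem radialIntegral_eq [NeZero d] (p : ℝ) (φ : ℝ → ℝ) :
    radialIntegral d p φ = d * volume.real (Metric.ball (0 : EuclideanSpace ℝ (Fin d)) 1) *
      ∫ y in Set.Ioi (0 : ℝ), y ^ (d - 1) • (φ y * y ^ (-p)) := by
  rw [radialIntegral, integral_fun_norm_addHaar volume (fun y : ℝ => φ y * y ^ (-p)),
    finrank_euclideanSpace_fin, nsmul_eq_mul, smul_eq_mul, mul_assoc]

theorem radialIntegral_indicator_one_pos [NeZero d] {p : ℝ} (hp : (d : ℝ) < p) :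
    0 < radialIntegral d p (fun x => if 1 ≤ x then 1 else 0) := by
  rw [radialIntegral_eq, integral_indicator_mul_rpow NeZero.one_le hp one_pos]
  have h1 : 0 < volume.real (Metric.ball (0 : EuclideanSpace ℝ (Fin d)) 1) :=
    ENNReal.toReal_pos (Metric.measure_ball_pos volume _ one_pos).ne' measure_ball_lt_top.ne
  have h2 : (0 : ℝ) < d := Nat.cast_pos.2 (NeZero.pos d)
  have h3 : 0 < p - d := by linarith
  positivity

theorem radialIntegral_indicator_div [NeZero d] {p c : ℝ} (hp : (d : ℝ) < p) (hc : 0 < c) :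
    radialIntegral d p (fun x => if c ≤ x then 1 else 0) /
      radialIntegral d p (fun x => if 1 ≤ x then 1 else 0) = c ^ (-(p - d)) := by
  have h0 := (radialIntegral_indicator_one_pos (d := d) hp).ne'
  have h3 : p - d ≠ 0 := by linarith
  rw [radialIntegral_eq, integral_indicator_mul_rpow NeZero.one_le hp one_pos] at h0
  rw [radialIntegral_eq, radialIntegral_eq, integral_indicator_mul_rpow NeZero.one_le hp one_pos,
    integral_indicator_mul_rpow NeZero.one_le hp hc, div_eq_iff h0,
    Real.one_rpow]
  ring

theorem radialIntegral_log_div [NeZero d] {p c : ℝ} (hp : (d : ℝ) < p) (hc : 0 < c) :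
    radialIntegral d p (fun x => Real.log (max (x / c) 1)) /
      radialIntegral d p (fun x => if 1 ≤ x then 1 else 0) = c ^ (-(p - d)) / (p - d) := by
  have h0 := (radialIntegral_indicator_one_pos (d := d) hp).ne'
  have h3 : p - d ≠ 0 := by linarith
  rw [radialIntegral_eq, integral_indicator_mul_rpow NeZero.one_le hp one_pos] at h0
  rw [radialIntegral_eq, radialIntegral_eq, integral_indicator_mul_rpow NeZero.one_le hp one_pos,
    integral_log_mul_rpow NeZero.one_le hp hc, div_eq_iff h0,
    Real.one_rpow]
  field_simp

end RadialWeights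

/-! ### Asymptotics of the first moments -/

section FirstMoments

variable {d : ℕ}

/-- A symmetric, translation invariant `{0, 1}`-valued function on `l`-tuples that vanishes unless
the points are within distance `L` of each other. -/
structure IsLocalKernel {l : ℕ} (h : (Fin l → EuclideanSpace ℝ (Fin d)) → ℝ) (L : ℝ) : Prop where
  measurable : Measurable h
  zero_or_one : ∀ y, h y = 0 ∨ h y = 1
  perm_invariant : ∀ (σ : Equiv.Perm (Fin l)) y, h (fun i => y (σ i)) = h y
  translation_invariant : ∀ x y, h (fun i => x + y i) = h y
  pos : 0 < L
  dist_le : ∀ y, h y ≠ 0 → ∀ i j, dist (y i) (y j) ≤ L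

theorem IsLocalKernel.nonneg {l : ℕ} {h : (Fin l → EuclideanSpace ℝ (Fin d)) → ℝ} {L : ℝ}
    (hh : IsLocalKernel h L) (y) : 0 ≤ h y := by
  rcases hh.zero_or_one y with h | h <;> simp [h]

theorem IsLocalKernel.le_one {l : ℕ} {h : (Fin l → EuclideanSpace ℝ (Fin d)) → ℝ} {L : ℝ}
    (hh : IsLocalKernel h L) (y) : h y ≤ 1 := by
  rcases hh.zero_or_one y with h | h <;> simp [h]

/-- The integrand whose sum over the point process, at scale `R`, is under study. -/
def scaledKernel {l : ℕ} (h : (Fin l → EuclideanSpace ℝ (Fin d)) → ℝ) (φ : ℝ → ℝ) (R : ℝ)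
    (y : Fin l → EuclideanSpace ℝ (Fin d)) : ℝ :=
  h y * φ ((⨅ i, ‖y i‖) / R)

theorem measurable_scaledKernel {l : ℕ} {h : (Fin l → EuclideanSpace ℝ (Fin d)) → ℝ}
    (hh : Measurable h) {φ : ℝ → ℝ} (hφ : Measurable φ) (R : ℝ) :
    Measurable (scaledKernel h φ R) := by
  refine hh.mul (hφ.comp ((Measurable.iInf fun i => ?_).div_const R))
  fun_prop

/-- The integral of `scaledKernel h φ R` against the product of the radial densities `g`. -/
def kernelIntegral {l : ℕ} (h : (Fin l → EuclideanSpace ℝ (Fin d)) → ℝ) (φ : ℝ → ℝ) (g : ℝ → ℝ)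
    (R : ℝ) : ℝ≥0∞ :=
  ∫⁻ y, ENNReal.ofReal (scaledKernel h φ R y) * ∏ i, ENNReal.ofReal (g ‖y i‖)

theorem measurable_scaledKernel_mul_prod {l : ℕ} {h : (Fin l → EuclideanSpace ℝ (Fin d)) → ℝ}
    (hh : Measurable h) {φ g : ℝ → ℝ} (hφ : Measurable φ) (hg : Measurable g) (R : ℝ) :
    Measurable fun y : Fin l → EuclideanSpace ℝ (Fin d) =>
      ENNReal.ofReal (scaledKernel h φ R y) * ∏ i, ENNReal.ofReal (g ‖y i‖) := by
  have := measurable_scaledKernel hh hφ R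
  fun_prop

theorem measurable_add_cons (K : ℕ) (R : ℝ) :
    Measurable fun p : EuclideanSpace ℝ (Fin d) × (Fin K → EuclideanSpace ℝ (Fin d)) =>
      fun i : Fin (K + 1) => R • p.1 + (Fin.cons 0 p.2 : Fin (K + 1) → EuclideanSpace ℝ (Fin d)) i := by
  refine measurable_pi_lambda _ fun i => ?_
  refine Fin.cases ?_ (fun j => ?_) i
  · simp only [Fin.cons_zero]; fun_prop
  · simp only [Fin.cons_succ]; fun_prop

/-- The change of variables `y = (R u, R u + z₁, …, R u + z_K)`. -/
theorem lintegral_eq_lintegral_cons {K : ℕ} {R : ℝ} (hR : 0 < R)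
    {G : (Fin (K + 1) → EuclideanSpace ℝ (Fin d)) → ℝ≥0∞} (hG : Measurable G) :
    ∫⁻ y, G y = ENNReal.ofReal (R ^ d) *
      ∫⁻ p : EuclideanSpace ℝ (Fin d) × (Fin K → EuclideanSpace ℝ (Fin d)),
        G (fun i => R • p.1 + (Fin.cons 0 p.2 : Fin (K + 1) → EuclideanSpace ℝ (Fin d)) i) := by
  let H : EuclideanSpace ℝ (Fin d) → ℝ≥0∞ := fun x =>
    ∫⁻ z : Fin K → EuclideanSpace ℝ (Fin d),
      G (fun i => x + (Fin.cons 0 z : Fin (K + 1) → EuclideanSpace ℝ (Fin d)) i)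
  have hHm : Measurable H := by
    have := hG.comp (measurable_add_cons (d := d) K 1)
    simp only [one_smul] at this
    exact this.lintegral_prod_right'
  have h1 : ∫⁻ y, G y = ∫⁻ x, H x := by
    rw [← (volume_preserving_piFinSuccAbove (fun _ : Fin (K + 1) => EuclideanSpace ℝ (Fin d))
      0).symm.lintegral_comp hG, Measure.volume_eq_prod, lintegral_prod]
    · refine lintegral_congr fun x => ?_
      rw [← lintegral_add_right_eq_self _ (fun _ => x)]
      refine lintegral_congr fun z => ?_
      congr 1
      funext i
      refine Fin.cases ?_ (fun j => ?_) i
      · simp [MeasurableEquiv.piFinSuccAbove_symm_apply]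
      · simp [MeasurableEquiv.piFinSuccAbove_symm_apply, add_comm]
    · exact (hG.comp (MeasurableEquiv.measurable _)).aemeasurable
  have h2 : ∫⁻ u, H (R • u) = ENNReal.ofReal (R ^ d)⁻¹ * ∫⁻ x, H x := by
    rw [← lintegral_map hHm (measurable_const_smul R), Measure.map_addHaar_smul _ hR.ne',
      lintegral_smul_measure, finrank_euclideanSpace_fin, abs_of_pos (by positivity), smul_eq_mul]
  have h3 : ∫⁻ p : EuclideanSpace ℝ (Fin d) × (Fin K → EuclideanSpace ℝ (Fin d)),
        G (fun i => R • p.1 + (Fin.cons 0 p.2 : Fin (K + 1) → EuclideanSpace ℝ (Fin d)) i) =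
      ∫⁻ u, H (R • u) := by
    rw [Measure.volume_eq_prod]
    exact lintegral_prod _ (hG.comp (measurable_add_cons K R)).aemeasurable
  rw [h3, h2, h1, ← mul_assoc, ← ENNReal.ofReal_mul (by positivity),
    mul_inv_cancel₀ (by positivity), ENNReal.ofReal_one, one_mul]

theorem norm_cons_zero_le {K : ℕ} (z : Fin K → EuclideanSpace ℝ (Fin d)) (i : Fin (K + 1)) :
    ‖(Fin.cons 0 z : Fin (K + 1) → EuclideanSpace ℝ (Fin d)) i‖ ≤ ‖z‖ := by
  refine Fin.cases ?_ (fun j => ?_) i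
  · simp
  · rw [Fin.cons_succ]; exact norm_le_pi_norm z j

/-- The integral of `h(0, z₁, …, z_K)` over the shapes `z` of the tuples. -/
def shapeIntegral {K : ℕ} (h : (Fin (K + 1) → EuclideanSpace ℝ (Fin d)) → ℝ) : ℝ :=
  ∫ z : Fin K → EuclideanSpace ℝ (Fin d), h (Fin.cons 0 z)

theorem IsLocalKernel.shapeIntegral_nonneg {K : ℕ}
    {h : (Fin (K + 1) → EuclideanSpace ℝ (Fin d)) → ℝ} {L : ℝ} (hh : IsLocalKernel h L) :
    0 ≤ shapeIntegral h :=
  integral_nonneg fun _ => hh.nonneg _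

theorem IsLayerWeight.radialIntegral_nonneg {φ : ℝ → ℝ} {c p : ℝ} (hφ : IsLayerWeight φ c) :
    0 ≤ radialIntegral d p φ :=
  integral_nonneg fun _ => mul_nonneg (hφ.nonneg _) (by positivity)

theorem measurable_cons_zero (K : ℕ) :
    Measurable fun z : Fin K → EuclideanSpace ℝ (Fin d) =>
      (Fin.cons 0 z : Fin (K + 1) → EuclideanSpace ℝ (Fin d)) := by
  refine measurable_pi_lambda _ fun i => ?_
  refine Fin.cases ?_ (fun j => ?_) i
  · simp only [Fin.cons_zero]; fun_prop
  · simp only [Fin.cons_succ]; fun_prop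

theorem IsLocalKernel.norm_le {K : ℕ} {h : (Fin (K + 1) → EuclideanSpace ℝ (Fin d)) → ℝ} {L : ℝ}
    (hh : IsLocalKernel h L) {z : Fin K → EuclideanSpace ℝ (Fin d)} (hz : h (Fin.cons 0 z) ≠ 0) :
    ‖z‖ ≤ L := by
  rw [pi_norm_le_iff_of_nonneg hh.pos.le]
  intro j
  have := hh.dist_le _ hz j.succ 0
  rwa [Fin.cons_succ, Fin.cons_zero, dist_zero_right] at this

theorem IsLocalKernel.integrable_cons {K : ℕ}
    {h : (Fin (K + 1) → EuclideanSpace ℝ (Fin d)) → ℝ} {L : ℝ} (hh : IsLocalKernel h L) :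
    Integrable fun z : Fin K → EuclideanSpace ℝ (Fin d) => h (Fin.cons 0 z) := by
  have h1 : Integrable ((Metric.closedBall (0 : Fin K → EuclideanSpace ℝ (Fin d)) L).indicator
      fun _ => (1 : ℝ)) :=
    (integrable_indicator_iff Metric.isClosed_closedBall.measurableSet).2
      (integrableOn_const measure_closedBall_lt_top.ne)
  refine h1.mono' (hh.measurable.comp (measurable_cons_zero K)).aestronglyMeasurable
    (ae_of_all _ fun z => ?_)
  rw [Real.norm_of_nonneg (hh.nonneg _)]
  by_cases hz : h (Fin.cons 0 z) = 0
  · rw [hz]; exact Set.indicator_nonneg (fun _ _ => zero_le_one) _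
  · rw [Set.indicator_of_mem (mem_closedBall_zero_iff.2 (hh.norm_le hz))]
    exact hh.le_one _

section Asymptotics

variable {K : ℕ} {h : (Fin (K + 1) → EuclideanSpace ℝ (Fin d)) → ℝ} {L c α : ℝ} {φ g : ℝ → ℝ}

/-- Pointwise limit of the integrand after the change of variables and division by `g(R)^(K+1)`: on
the scale `R` all points of a local tuple lie at the same place `u`. -/
theorem tendsto_scaledKernel_mul_prod (hh : IsLocalKernel h L) (hφ : IsLayerWeight φ c)
    (hg : IsRegVarying g α) {R : ℕ → ℝ} (hR : Tendsto R atTop atTop)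
    {u : EuclideanSpace ℝ (Fin d)} (hu0 : u ≠ 0) (huc : ‖u‖ ≠ c)
    (z : Fin K → EuclideanSpace ℝ (Fin d)) :
    Tendsto (fun n => scaledKernel h φ (R n) (fun i => R n • u +
        (Fin.cons 0 z : Fin (K + 1) → EuclideanSpace ℝ (Fin d)) i) *
      ∏ i, g ‖R n • u + (Fin.cons 0 z : Fin (K + 1) → EuclideanSpace ℝ (Fin d)) i‖ / g (R n))
      atTop (𝓝 (h (Fin.cons 0 z) * (φ ‖u‖ * ‖u‖ ^ (-(α * (K + 1)))))) := by
  set y : ℕ → Fin (K + 1) → EuclideanSpace ℝ (Fin d) := fun n i => R n • u +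
        (Fin.cons 0 z : Fin (K + 1) → EuclideanSpace ℝ (Fin d)) i with hy
  have hu : 0 < ‖u‖ := norm_pos_iff.2 hu0
  have hzR : Tendsto (fun n => ‖z‖ / R n) atTop (𝓝 0) := hR.const_div_atTop _
  have hbd : ∀ n, 0 < R n → ∀ i, ‖u‖ - ‖z‖ / R n ≤ ‖y n i‖ / R n ∧
      ‖y n i‖ / R n ≤ ‖u‖ + ‖z‖ / R n := by
    intro n hn i
    have h1 := norm_cons_zero_le z i
    have h2 : ‖R n • u‖ = R n * ‖u‖ := by rw [norm_smul, Real.norm_of_nonneg hn.le]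
    have h3 : ‖y n i‖ ≤ ‖R n • u‖ + _ := norm_add_le _ _
    have h4 : ‖R n • u‖ - _ ≤ ‖y n i‖ := norm_sub_le_norm_add _ _
    rw [h2] at h3 h4
    constructor
    · rw [le_div_iff₀ hn, sub_mul, div_mul_cancel₀ _ hn.ne']
      linarith
    · rw [div_le_iff₀ hn, add_mul, div_mul_cancel₀ _ hn.ne']
      linarith
  have hlow : Tendsto (fun n => ‖u‖ - ‖z‖ / R n) atTop (𝓝 ‖u‖) := by
    simpa using tendsto_const_nhds.sub hzR
  have hupp : Tendsto (fun n => ‖u‖ + ‖z‖ / R n) atTop (𝓝 ‖u‖) := by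
    simpa using tendsto_const_nhds.add hzR
  have hcoord : ∀ i, Tendsto (fun n => ‖y n i‖ / R n) atTop (𝓝 ‖u‖) := by
    intro i
    refine tendsto_of_tendsto_of_tendsto_of_le_of_le' hlow hupp ?_ ?_
    · filter_upwards [hR.eventually_gt_atTop 0] with n hn using (hbd n hn i).1
    · filter_upwards [hR.eventually_gt_atTop 0] with n hn using (hbd n hn i).2
  have hmin : Tendsto (fun n => (⨅ i, ‖y n i‖) / R n) atTop (𝓝 ‖u‖) := by
    refine tendsto_of_tendsto_of_tendsto_of_le_of_le' hlow hupp ?_ ?_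
    · filter_upwards [hR.eventually_gt_atTop 0] with n hn
      rw [le_div_iff₀ hn]
      exact le_ciInf fun i => (le_div_iff₀ hn).1 (hbd n hn i).1
    · filter_upwards [hR.eventually_gt_atTop 0] with n hn
      refine le_trans ?_ (hbd n hn 0).2
      gcongr
      exact ciInf_le (Set.finite_range _).bddBelow 0
  have hker : ∀ n, h (y n) = h (Fin.cons 0 z) := fun n =>
    hh.translation_invariant (R n • u) (Fin.cons 0 z)
  have hφ' : Tendsto (fun n => φ ((⨅ i, ‖y n i‖) / R n)) atTop (𝓝 (φ ‖u‖)) :=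
    (hφ.continuousAt _ huc).tendsto.comp hmin
  have hprod : Tendsto (fun n => ∏ i, g ‖y n i‖ / g (R n)) atTop
      (𝓝 (∏ _i : Fin (K + 1), ‖u‖ ^ (-α))) :=
    tendsto_finsetProd _ fun i _ => hg.tendsto_div hu hR (hcoord i)
  rw [Finset.prod_const, Finset.card_univ, Fintype.card_fin, ← Real.rpow_natCast,
    ← Real.rpow_mul hu.le, Nat.cast_add, Nat.cast_one, neg_mul] at hprod
  have := (hφ'.mul hprod).const_mul (h (Fin.cons 0 z))
  refine this.congr fun n => ?_
  rw [← hker n, scaledKernel, mul_assoc]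

/-- A dominating function for the rescaled integrand, from Potter's bound. Where the integrand does
not vanish, every point of the tuple has norm at least `R ‖u‖ / 2`. -/
theorem eventually_scaledKernel_mul_prod_le (hh : IsLocalKernel h L) (hφ : IsLayerWeight φ c)
    (hg : IsRegVarying g α) {R : ℕ → ℝ} (hR : Tendsto R atTop atTop) {ε : ℝ} (hε : 0 < ε)
    (hεα : ε < α) :
    ∃ C, ∀ᶠ n in atTop, ∀ (u : EuclideanSpace ℝ (Fin d)) (z : Fin K → EuclideanSpace ℝ (Fin d)),
      scaledKernel h φ (R n) (fun i => R n • u +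
        (Fin.cons 0 z : Fin (K + 1) → EuclideanSpace ℝ (Fin d)) i) *
      ∏ i, g ‖R n • u + (Fin.cons 0 z : Fin (K + 1) → EuclideanSpace ℝ (Fin d)) i‖ / g (R n) ≤
      C * ((if c ≤ ‖u‖ then (1 : ℝ) else 0) * ‖u‖ ^ (-(α * (K + 1) - ε * (K + 2)))) *
        (Metric.closedBall (0 : Fin K → EuclideanSpace ℝ (Fin d)) L).indicator (fun _ => 1) z := by
  obtain ⟨C₁, hC₁⟩ := hφ.growth ε hε
  obtain ⟨C₂, hC₂, T, hT, hpot⟩ := hg.exists_div_le hε (half_pos hφ.pos)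
  refine ⟨C₁ * (C₂ * 2 ^ (α - ε)) ^ (K + 1), ?_⟩
  have hc := hφ.pos
  filter_upwards [hR.eventually_ge_atTop T, hR.eventually_ge_atTop (2 * L / c),
    hR.eventually_gt_atTop 0] with n hRT hRL hR0 u z
  have hgR := (hpot _ hRT).1
  set y : Fin (K + 1) → EuclideanSpace ℝ (Fin d) := fun i => R n • u +
        (Fin.cons 0 z : Fin (K + 1) → EuclideanSpace ℝ (Fin d)) i with hy
  have hker : h y = h (Fin.cons 0 z) := hh.translation_invariant (R n • u) (Fin.cons 0 z)
  have hC₁0 : 0 ≤ C₁ := by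
    have h1 := (hφ.nonneg c).trans (hC₁ c le_rfl)
    exact nonneg_of_mul_nonneg_left h1 (by positivity)
  have hrhs : 0 ≤ C₁ * (C₂ * 2 ^ (α - ε)) ^ (K + 1) * ((if c ≤ ‖u‖ then (1 : ℝ) else 0) *
      ‖u‖ ^ (-(α * (K + 1) - ε * (K + 2)))) *
        (Metric.closedBall (0 : Fin K → EuclideanSpace ℝ (Fin d)) L).indicator (fun _ => 1) z := by
    have h1 : 0 ≤ (Metric.closedBall (0 : Fin K → EuclideanSpace ℝ (Fin d)) L).indicator
      (fun _ => (1 : ℝ)) z := Set.indicator_nonneg (fun _ _ => zero_le_one) _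
    positivity
  by_cases hzero : scaledKernel h φ (R n) y = 0
  · rw [hzero, zero_mul]; exact hrhs
  obtain ⟨hz, hφ0⟩ := mul_ne_zero_iff.1 hzero
  rw [hker] at hz
  have hzL := hh.norm_le hz
  have hy0 : ‖y 0‖ = R n * ‖u‖ := by
    simp only [hy, Fin.cons_zero, add_zero]
    rw [norm_smul, Real.norm_of_nonneg hR0.le]
  have hmin_le : (⨅ i, ‖y i‖) / R n ≤ ‖u‖ := by
    rw [div_le_iff₀ hR0, mul_comm, ← hy0]
    exact ciInf_le (Set.finite_range _).bddBelow 0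
  have huc : c ≤ ‖u‖ := (hφ.le_of_ne_zero hφ0).trans hmin_le
  have hu0 : 0 < ‖u‖ := hc.trans_le huc
  have hRL' : L ≤ c / 2 * R n := by
    rw [div_le_iff₀ hc] at hRL
    linarith
  have hyi : ∀ i, ‖u‖ / 2 * R n ≤ ‖y i‖ := by
    intro i
    have h1 := (norm_cons_zero_le z i).trans hzL
    have h4 : ‖R n • u‖ - _ ≤ ‖y i‖ := norm_sub_le_norm_add _ _
    rw [norm_smul, Real.norm_of_nonneg hR0.le] at h4
    nlinarith
  have hgi : ∀ i, g ‖y i‖ / g (R n) ≤ C₂ * 2 ^ (α - ε) * ‖u‖ ^ (-α + ε) := by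
    intro i
    have h1 := hyi i
    have h2 : c / 2 * R n ≤ ‖y i‖ := le_trans (by gcongr) h1
    refine ((hpot _ hRT).2 _ h2).trans ?_
    rw [mul_assoc]
    refine mul_le_mul_of_nonneg_left ?_ hC₂.le
    refine (Real.rpow_le_rpow_of_nonpos (x := ‖u‖ / 2) (by positivity)
      ((le_div_iff₀ hR0).2 h1) (by linarith)).trans_eq ?_
    rw [Real.div_rpow hu0.le (by norm_num), show -α + ε = -(α - ε) by ring,
      Real.rpow_neg (by norm_num : (0 : ℝ) ≤ 2), div_inv_eq_mul, mul_comm]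
  have hprod : ∏ i, g ‖y i‖ / g (R n) ≤ (C₂ * 2 ^ (α - ε) * ‖u‖ ^ (-α + ε)) ^ (K + 1) := by
    refine (Finset.prod_le_prod (fun i _ => div_nonneg (hg.nonneg _) hgR.le)
      fun i _ => hgi i).trans_eq ?_
    rw [Finset.prod_const, Finset.card_univ, Fintype.card_fin]
  have hsk : scaledKernel h φ (R n) y ≤ C₁ * ‖u‖ ^ ε := by
    rw [scaledKernel]
    calc h y * φ ((⨅ i, ‖y i‖) / R n) ≤ 1 * φ ‖u‖ :=
          mul_le_mul (hh.le_one _) (hφ.mono hmin_le) (hφ.nonneg _) zero_le_one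
      _ ≤ _ := by rw [one_mul]; exact hC₁ _ huc
  rw [if_pos huc, one_mul, Set.indicator_of_mem (mem_closedBall_zero_iff.2 hzL), mul_one]
  calc _ ≤ C₁ * ‖u‖ ^ ε * (C₂ * 2 ^ (α - ε) * ‖u‖ ^ (-α + ε)) ^ (K + 1) :=
        mul_le_mul hsk hprod (Finset.prod_nonneg fun i _ => div_nonneg (hg.nonneg _) hgR.le)
          (by positivity)
    _ = C₁ * (C₂ * 2 ^ (α - ε)) ^ (K + 1) * (‖u‖ ^ ε * (‖u‖ ^ (-α + ε)) ^ (K + 1)) := by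
        rw [mul_pow]; ring
    _ = _ := by
        rw [← Real.rpow_natCast (‖u‖ ^ (-α + ε)), ← Real.rpow_mul hu0.le, ← Real.rpow_add hu0]
        congr 2
        push_cast
        ring

/-- First moments at scale `R` are asymptotic to a constant times `R^d g(R)^(K+1)`. -/
theorem tendsto_kernelIntegral [NeZero d] (hh : IsLocalKernel h L) (hφ : IsLayerWeight φ c)
    (hg : IsRegVarying g α) (hα : (d : ℝ) < α) {R : ℕ → ℝ} (hR : Tendsto R atTop atTop) :
    (∀ᶠ n in atTop, kernelIntegral h φ g (R n) ≠ ∞) ∧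
    Tendsto (fun n => (kernelIntegral h φ g (R n)).toReal / (R n ^ d * g (R n) ^ (K + 1))) atTop
      (𝓝 (shapeIntegral h * radialIntegral d (α * (K + 1)) φ)) := by
  have hd0 : (0 : ℝ) ≤ d := Nat.cast_nonneg d
  have hK0 : (0 : ℝ) ≤ K := Nat.cast_nonneg K
  have hp : (d : ℝ) < α * (K + 1) := by nlinarith
  -- the loss in Potter's bound, small enough for the dominating function to stay integrable
  obtain ⟨ε, hε0, hεα, hε⟩ : ∃ ε : ℝ, 0 < ε ∧ ε < α ∧ (d : ℝ) < α * (K + 1) - ε * (K + 2) := by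
    refine ⟨(α * (K + 1) - d) / (2 * (K + 2)), by apply div_pos <;> linarith, ?_, ?_⟩
    · rw [div_lt_iff₀ (by linarith)]; nlinarith
    · have : (α * (K + 1) - d) / (2 * (K + 2)) * (K + 2) = (α * (K + 1) - d) / 2 := by field_simp
      rw [this]; linarith
  obtain ⟨C, hC⟩ := eventually_scaledKernel_mul_prod_le hh hφ hg hR hε0 hεα
  have hpos := hR.eventually hg.eventually_pos
  let q : ℕ → EuclideanSpace ℝ (Fin d) × (Fin K → EuclideanSpace ℝ (Fin d)) → ℝ := fun n p =>
    scaledKernel h φ (R n) (fun i => R n • p.1 +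
        (Fin.cons 0 p.2 : Fin (K + 1) → EuclideanSpace ℝ (Fin d)) i) *
      ∏ i, g ‖R n • p.1 + (Fin.cons 0 p.2 : Fin (K + 1) → EuclideanSpace ℝ (Fin d)) i‖ / g (R n)
  have hsk0 : ∀ n y, 0 ≤ scaledKernel h φ (R n) y := fun n y =>
    mul_nonneg (hh.nonneg _) (hφ.nonneg _)
  have heq : ∀ᶠ n in atTop, kernelIntegral h φ g (R n) =
      ENNReal.ofReal (R n ^ d * g (R n) ^ (K + 1)) * ∫⁻ p, ENNReal.ofReal (q n p) := by
    filter_upwards [hpos, hR.eventually_gt_atTop 0] with n hgn hRn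
    rw [kernelIntegral, lintegral_eq_lintegral_cons hRn
      (measurable_scaledKernel_mul_prod hh.measurable hφ.measurable hg.measurable _),
      ENNReal.ofReal_mul (by positivity), mul_assoc]
    congr 1
    rw [← lintegral_const_mul' _ _ ENNReal.ofReal_ne_top]
    refine lintegral_congr fun p => ?_
    rw [← ENNReal.ofReal_mul (by positivity), ← ENNReal.ofReal_prod_of_nonneg
      fun i _ => hg.nonneg _, ← ENNReal.ofReal_mul (hsk0 _ _)]
    congr 1
    simp only [q]
    rw [Finset.prod_div_distrib, Finset.prod_const, Finset.card_univ, Fintype.card_fin]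
    field_simp
  have hlim : Tendsto (fun n => ∫⁻ p, ENNReal.ofReal (q n p)) atTop
      (𝓝 (ENNReal.ofReal (shapeIntegral h * radialIntegral d (α * (K + 1)) φ))) := by
    have hI : ENNReal.ofReal (shapeIntegral h * radialIntegral d (α * (K + 1)) φ) =
        ∫⁻ p : EuclideanSpace ℝ (Fin d) × (Fin K → EuclideanSpace ℝ (Fin d)),
          ENNReal.ofReal (h (Fin.cons 0 p.2) * (φ ‖p.1‖ * ‖p.1‖ ^ (-(α * (K + 1))))) := by
      have hφi := hφ.integrable (d := d) hp
      rw [shapeIntegral, radialIntegral,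
        ENNReal.ofReal_mul (integral_nonneg fun z => hh.nonneg _),
        ofReal_integral_eq_lintegral_ofReal hh.integrable_cons (ae_of_all _ fun z => hh.nonneg _),
        ofReal_integral_eq_lintegral_ofReal hφi
          (ae_of_all _ fun u => mul_nonneg (hφ.nonneg _) (by positivity)),
        mul_comm, Measure.volume_eq_prod]
      rw [← lintegral_prod_mul hφi.aestronglyMeasurable.aemeasurable.ennreal_ofReal
        hh.integrable_cons.aestronglyMeasurable.aemeasurable.ennreal_ofReal]
      refine lintegral_congr fun p => ?_
      rw [← ENNReal.ofReal_mul (mul_nonneg (hφ.nonneg _) (by positivity)), mul_comm]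
    rw [hI]
    have hdomI : Integrable fun p : EuclideanSpace ℝ (Fin d) ×
        (Fin K → EuclideanSpace ℝ (Fin d)) =>
        C * ((if c ≤ ‖p.1‖ then (1 : ℝ) else 0) * ‖p.1‖ ^ (-(α * (K + 1) - ε * (K + 2)))) *
        (Metric.closedBall (0 : Fin K → EuclideanSpace ℝ (Fin d)) L).indicator
          (fun _ => 1) p.2 := by
      rw [Measure.volume_eq_prod]
      exact ((integrable_norm_rpow_of_lt hε hφ.pos).const_mul C).mul_prod
        ((integrable_indicator_iff Metric.isClosed_closedBall.measurableSet).2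
          (integrableOn_const measure_closedBall_lt_top.ne))
    refine tendsto_lintegral_filter_of_dominated_convergence (fun p => ENNReal.ofReal
      (C * ((if c ≤ ‖p.1‖ then (1 : ℝ) else 0) * ‖p.1‖ ^ (-(α * (K + 1) - ε * (K + 2)))) *
        (Metric.closedBall (0 : Fin K → EuclideanSpace ℝ (Fin d)) L).indicator
          (fun _ => 1) p.2)) ?_ ?_ ?_ ?_
    · refine Eventually.of_forall fun n => ENNReal.measurable_ofReal.comp (Measurable.mul ?_ ?_)
      · exact (measurable_scaledKernel hh.measurable hφ.measurable (R n)).comp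
          (measurable_add_cons K (R n))
      · refine Finset.measurable_fun_prod _ fun i _ => Measurable.div_const ?_ _
        exact hg.measurable.comp (measurable_norm.comp
          ((measurable_pi_apply i).comp (measurable_add_cons K (R n))))
    · filter_upwards [hC] with n hn
      exact ae_of_all _ fun p => ENNReal.ofReal_le_ofReal (hn p.1 p.2)
    · exact (Integrable.lintegral_lt_top hdomI).ne
    · have hae : ∀ᵐ u : EuclideanSpace ℝ (Fin d), u ≠ 0 ∧ ‖u‖ ≠ c := by
        rw [ae_iff]
        refine measure_mono_null (t := {0} ∪ Metric.sphere 0 c) (fun u hu => ?_)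
          (measure_union_null (measure_singleton 0) (Measure.addHaar_sphere _ _ _))
        simp only [Set.mem_ofPred_eq, not_and_or, not_not] at hu
        rcases hu with hu | hu
        · exact Or.inl hu
        · exact Or.inr (mem_sphere_zero_iff_norm.2 hu)
      rw [Measure.volume_eq_prod]
      filter_upwards [Measure.quasiMeasurePreserving_fst.ae hae] with p hp
      exact (ENNReal.continuous_ofReal.tendsto _).comp
        (tendsto_scaledKernel_mul_prod hh hφ hg hR hp.1 hp.2 p.2)
  have hfin : ∀ᶠ n in atTop, ∫⁻ p, ENNReal.ofReal (q n p) ≠ ∞ := by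
    filter_upwards [hlim.eventually (gt_mem_nhds ENNReal.ofReal_lt_top)] with n hn using hn.ne
  refine ⟨?_, ?_⟩
  · filter_upwards [heq, hfin] with n h1 h2
    rw [h1]
    exact ENNReal.mul_ne_top ENNReal.ofReal_ne_top h2
  · have h1 := (ENNReal.tendsto_toReal ENNReal.ofReal_ne_top).comp hlim
    rw [ENNReal.toReal_ofReal (mul_nonneg hh.shapeIntegral_nonneg hφ.radialIntegral_nonneg)] at h1
    refine h1.congr' ?_
    filter_upwards [heq, hpos, hR.eventually_gt_atTop 0] with n h2 h3 h4
    rw [h2, ENNReal.toReal_mul, ENNReal.toReal_ofReal (by positivity),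
      mul_div_cancel_left₀ _ (by positivity)]
    rfl

end Asymptotics

end FirstMoments

/-! ### Moments of sums over subsets of a Poisson process -/

section Moments

variable {Ω E : Type*} [MeasurableSpace Ω] [MeasurableSpace E] [TopologicalSpace E] [BorelSpace E]
  [T2Space E] [SecondCountableTopology E] {N : Ω → Finset E} {Λ : Measure E} {μ : Measure Ω}

theorem IsPoissonProcess.measurable_sum_onSet (hN : IsPoissonProcess N Λ μ) {l : ℕ}
    {F : (Fin l → E) → ℝ} (hF : Measurable F) (hF0 : ∀ y, 0 ≤ F y)
    (hFs : ∀ (σ : Equiv.Perm (Fin l)) y, F (fun i => y (σ i)) = F y) :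
    Measurable fun ω => ∑ Y ∈ (N ω).powersetCard l, onSet F Y := by
  have h1 := (hN.measurable_sum_injTuples hF.ennreal_ofReal).ennreal_toReal.const_mul (l.factorial : ℝ)⁻¹
  convert h1 using 2 with ω
  rw [← ENNReal.ofReal_sum_of_nonneg fun x _ => hF0 x,
    ENNReal.toReal_ofReal (Finset.sum_nonneg fun x _ => hF0 x), sum_injTuples_eq hFs,
    inv_mul_cancel_left₀ (by positivity)]

theorem IsPoissonProcess.lintegral_sum_onSet (hN : IsPoissonProcess N Λ μ) [SigmaFinite Λ] {l : ℕ}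
    (hdiag : ∀ i j : Fin l, i ≠ j → Measure.pi (fun _ => Λ) {x | x i = x j} = 0)
    {F : (Fin l → E) → ℝ} (hF : Measurable F) (hF0 : ∀ y, 0 ≤ F y)
    (hFs : ∀ (σ : Equiv.Perm (Fin l)) y, F (fun i => y (σ i)) = F y) :
    ENNReal.ofReal l.factorial * ∫⁻ ω, ENNReal.ofReal (∑ Y ∈ (N ω).powersetCard l, onSet F Y) ∂μ =
      ∫⁻ x, ENNReal.ofReal (F x) ∂(Measure.pi fun _ => Λ) := by
  rw [← hN.lintegral_sum_injTuples hdiag hF.ennreal_ofReal,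
    ← lintegral_const_mul' _ _ ENNReal.ofReal_ne_top]
  refine lintegral_congr fun ω => ?_
  rw [← ENNReal.ofReal_sum_of_nonneg fun x _ => hF0 x, sum_injTuples_eq hFs,
    ENNReal.ofReal_mul (by positivity)]

/-- Disjoint pairs are uncorrelated: their contribution to the second moment is the square of the
first moment. -/
theorem IsPoissonProcess.lintegral_sum_disjoint [DecidableEq E] (hN : IsPoissonProcess N Λ μ)
    [SigmaFinite Λ] {l : ℕ}
    (hdiag : ∀ (ι : Type) [Fintype ι] (i j : ι), i ≠ j →
      Measure.pi (fun _ : ι => Λ) {x | x i = x j} = 0)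
    {F : (Fin l → E) → ℝ} (hF : Measurable F) (hF0 : ∀ y, 0 ≤ F y)
    (hFs : ∀ (σ : Equiv.Perm (Fin l)) y, F (fun i => y (σ i)) = F y) :
    ∫⁻ ω, ENNReal.ofReal (∑ Y ∈ (N ω).powersetCard l, ∑ Y' ∈ (N ω).powersetCard l,
        if Disjoint Y Y' then onSet F Y * onSet F Y' else 0) ∂μ =
      (∫⁻ ω, ENNReal.ofReal (∑ Y ∈ (N ω).powersetCard l, onSet F Y) ∂μ) ^ 2 := by
  have hc0 : ENNReal.ofReal ((l.factorial : ℝ) ^ 2) ≠ 0 := by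
    rw [ne_eq, ENNReal.ofReal_eq_zero, not_le]; positivity
  refine (ENNReal.mul_right_inj hc0 ENNReal.ofReal_ne_top).1 ?_
  rw [ENNReal.ofReal_pow (by positivity), ← mul_pow, hN.lintegral_sum_onSet (hdiag _) hF hF0 hFs,
    ← ENNReal.ofReal_pow (by positivity), ← lintegral_const_mul' _ _ ENNReal.ofReal_ne_top]
  have hm : Measurable fun z : Fin l ⊕ Fin l → E =>
      ENNReal.ofReal (F (z ∘ Sum.inl)) * ENNReal.ofReal (F (z ∘ Sum.inr)) := by
    refine (ENNReal.measurable_ofReal.comp (hF.comp ?_)).mul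
      (ENNReal.measurable_ofReal.comp (hF.comp ?_)) <;>
    exact measurable_pi_lambda _ fun i => measurable_pi_apply _
  have h1 := hN.lintegral_sum_injTuples (hdiag (Fin l ⊕ Fin l)) hm
  have h2 : ∫⁻ z, ENNReal.ofReal (F (z ∘ Sum.inl)) * ENNReal.ofReal (F (z ∘ Sum.inr))
      ∂(Measure.pi fun _ : Fin l ⊕ Fin l => Λ) =
      (∫⁻ x, ENNReal.ofReal (F x) ∂(Measure.pi fun _ => Λ)) ^ 2 := by
    rw [← (measurePreserving_sumPiEquivProdPi_symm (fun _ : Fin l ⊕ Fin l => Λ)).lintegral_comp hm,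
      sq]
    exact lintegral_prod_mul hF.ennreal_ofReal.aemeasurable hF.ennreal_ofReal.aemeasurable
  rw [← h2, ← h1]
  refine lintegral_congr fun ω => ?_
  rw [← ENNReal.ofReal_mul (by positivity)]
  simp_rw [← ENNReal.ofReal_mul (hF0 _)]
  rw [← ENNReal.ofReal_sum_of_nonneg fun z _ => mul_nonneg (hF0 _) (hF0 _), sum_injTuples_sum hFs]
  congr!

/-- The second moment exceeds the square of the first by at most the contribution of overlapping
pairs. -/
theorem IsPoissonProcess.lintegral_sq_sum_onSet_le [DecidableEq E] (hN : IsPoissonProcess N Λ μ)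
    [SigmaFinite Λ] {k : ℕ}
    (hdiag : ∀ (ι : Type) [Fintype ι] (i j : ι), i ≠ j →
      Measure.pi (fun _ : ι => Λ) {x | x i = x j} = 0)
    {F : (Fin k → E) → ℝ} (hF : Measurable F) (hF0 : ∀ y, 0 ≤ F y)
    (hFs : ∀ (σ : Equiv.Perm (Fin k)) y, F (fun i => y (σ i)) = F y)
    {G : Finset E → ℝ} (hG : ∀ Z, 0 ≤ G Z)
    (hGm : ∀ l, Measurable fun ω => ∑ Z ∈ (N ω).powersetCard l, G Z)
    (hFG : ∀ Y Y' : Finset E, Y.card = k → Y'.card = k → ¬ Disjoint Y Y' →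
      onSet F Y * onSet F Y' ≤ G (Y ∪ Y')) :
    ∫⁻ ω, ENNReal.ofReal ((∑ Y ∈ (N ω).powersetCard k, onSet F Y) ^ 2) ∂μ ≤
      (∫⁻ ω, ENNReal.ofReal (∑ Y ∈ (N ω).powersetCard k, onSet F Y) ∂μ) ^ 2 +
      ∑ l ∈ Finset.Ico k (2 * k), ENNReal.ofReal (4 ^ l) *
        ∫⁻ ω, ENNReal.ofReal (∑ Z ∈ (N ω).powersetCard l, G Z) ∂μ := by
  rw [← hN.lintegral_sum_disjoint hdiag hF hF0 hFs]
  simp_rw [← lintegral_const_mul' _ _ ENNReal.ofReal_ne_top]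
  rw [← lintegral_finsetSum _ fun l _ => (hGm l).ennreal_ofReal.const_mul _,
    ← lintegral_add_right _ (Finset.measurable_fun_sum _ fun l _ =>
      (hGm l).ennreal_ofReal.const_mul _)]
  refine lintegral_mono fun ω => ?_
  refine (ENNReal.ofReal_le_ofReal (sq_sum_powersetCard_le (N ω) hG hFG)).trans ?_
  refine ENNReal.ofReal_add_le.trans ?_
  gcongr
  rw [ENNReal.ofReal_sum_of_nonneg fun l _ => mul_nonneg (by positivity)
    (Finset.sum_nonneg fun Z _ => hG Z)]
  refine Finset.sum_le_sum fun l _ => ?_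
  rw [ENNReal.ofReal_mul (by positivity)]

end Moments

/-- Chebyshev's inequality: convergence of first moments, with vanishing excess of the second
moment, gives convergence in probability. -/
theorem tendstoInMeasure_of_moments {Ω : Type*} [MeasurableSpace Ω] {μ : Measure Ω}
    [IsProbabilityMeasure μ] {X : ℕ → Ω → ℝ} {c : ℝ} (hc : 0 ≤ c) {e δ : ℕ → ℝ≥0∞}
    (hX : ∀ᶠ n in atTop, Measurable (X n) ∧ (∀ ω, 0 ≤ X n ω) ∧
      ∫⁻ ω, ENNReal.ofReal (X n ω) ∂μ = e n ∧
      ∫⁻ ω, ENNReal.ofReal (X n ω ^ 2) ∂μ ≤ e n ^ 2 + δ n)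
    (he : Tendsto e atTop (𝓝 (ENNReal.ofReal c))) (hδ : Tendsto δ atTop (𝓝 0)) :
    TendstoInMeasure μ X atTop fun _ => c := by
  rw [tendstoInMeasure_iff_norm]
  intro ε hε
  have hlim : Tendsto (fun n => (e n ^ 2 + δ n + ENNReal.ofReal (c ^ 2)) -
      ENNReal.ofReal (2 * c) * e n) atTop (𝓝 0) := by
    have h1 : Tendsto (fun n => e n ^ 2 + δ n + ENNReal.ofReal (c ^ 2)) atTop
        (𝓝 (ENNReal.ofReal c ^ 2 + 0 + ENNReal.ofReal (c ^ 2))) :=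
      (((ENNReal.continuous_pow 2).tendsto _).comp he |>.add hδ).add tendsto_const_nhds
    have h2 : Tendsto (fun n => ENNReal.ofReal (2 * c) * e n) atTop
        (𝓝 (ENNReal.ofReal (2 * c) * ENNReal.ofReal c)) :=
      ENNReal.Tendsto.const_mul he (Or.inr ENNReal.ofReal_ne_top)
    have h3 := ENNReal.Tendsto.sub h1 h2 (Or.inr (by finiteness))
    convert h3 using 2
    rw [← ENNReal.ofReal_pow hc, ← ENNReal.ofReal_mul (by positivity), add_zero,
      ← ENNReal.ofReal_add (by positivity) (by positivity), ← ENNReal.ofReal_sub _ (by positivity)]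
    symm
    rw [ENNReal.ofReal_eq_zero]
    linarith [sq c]
  have hlim2 := ENNReal.Tendsto.mul_const (b := (ENNReal.ofReal (ε ^ 2))⁻¹) hlim
    (Or.inr (ENNReal.inv_ne_top.2 (ENNReal.ofReal_pos.2 (by positivity)).ne'))
  rw [zero_mul] at hlim2
  refine tendsto_of_tendsto_of_tendsto_of_le_of_le' tendsto_const_nhds hlim2
    (Eventually.of_forall fun _ => zero_le) ?_
  filter_upwards [hX, he.eventually (gt_mem_nhds ENNReal.ofReal_lt_top)] with n ⟨hm, h0, h1, h2⟩ he
  have hcheb : ENNReal.ofReal (ε ^ 2) * μ {ω | ε ≤ ‖X n ω - c‖} ≤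
      ∫⁻ ω, ENNReal.ofReal ((X n ω - c) ^ 2) ∂μ := by
    have := mul_meas_ge_le_lintegral (μ := μ)
      (f := fun ω => ENNReal.ofReal ((X n ω - c) ^ 2)) (by fun_prop) (ENNReal.ofReal (ε ^ 2))
    refine le_trans (mul_le_mul_right (measure_mono fun ω hω => ?_) _) this
    have hω : ε ≤ ‖X n ω - c‖ := hω
    refine ENNReal.ofReal_le_ofReal ?_
    rw [← sq_abs (X n ω - c), ← Real.norm_eq_abs]
    gcongr
  have hexp : ∫⁻ ω, ENNReal.ofReal ((X n ω - c) ^ 2) ∂μ + ENNReal.ofReal (2 * c) * e n =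
      ∫⁻ ω, ENNReal.ofReal (X n ω ^ 2) ∂μ + ENNReal.ofReal (c ^ 2) := by
    rw [← h1, ← lintegral_const_mul _ (by fun_prop), ← lintegral_add_left (by fun_prop)]
    have h3 : ENNReal.ofReal (c ^ 2) = ∫⁻ _, ENNReal.ofReal (c ^ 2) ∂μ := by simp
    rw [h3, ← lintegral_add_left (by fun_prop)]
    refine lintegral_congr fun ω => ?_
    have := h0 ω
    rw [← ENNReal.ofReal_mul (by positivity), ← ENNReal.ofReal_add (by positivity) (by positivity),
      ← ENNReal.ofReal_add (by positivity) (by positivity)]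
    congr 1
    ring
  rw [← div_eq_mul_inv, ENNReal.le_div_iff_mul_le
    (Or.inl (ENNReal.ofReal_pos.2 (by positivity)).ne') (Or.inl ENNReal.ofReal_ne_top), mul_comm]
  refine hcheb.trans (ENNReal.le_sub_of_add_le_right
    (ENNReal.mul_ne_top ENNReal.ofReal_ne_top he.ne) ?_)
  rw [hexp]
  gcongr

/-! ### Choice of the scale -/

section Scale

variable {d K : ℕ} {h : (Fin (K + 1) → EuclideanSpace ℝ (Fin d)) → ℝ} {L α : ℝ} {g : ℝ → ℝ}

theorem scaledKernel_indicator {l : ℕ} (h : (Fin l → EuclideanSpace ℝ (Fin d)) → ℝ)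
    {R : ℝ} (hR : 0 < R) (y : Fin l → EuclideanSpace ℝ (Fin d)) :
    scaledKernel h (fun x => if 1 ≤ x then 1 else 0) R y =
      h y * if R ≤ ⨅ i, ‖y i‖ then 1 else 0 := by
  simp only [scaledKernel, one_le_div hR]

theorem scaledKernel_indicator_le_one (hh : IsLocalKernel h L) (R : ℝ)
    (y : Fin (K + 1) → EuclideanSpace ℝ (Fin d)) :
    scaledKernel h (fun x => if 1 ≤ x then 1 else 0) R y ≤ 1 := by
  refine mul_le_one₀ (hh.le_one y) ?_ ?_ <;> dsimp only <;> split_ifs <;> norm_num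

theorem lintegral_prod_ofReal_norm (hg : Measurable g)
    (hg1 : ∫⁻ x : EuclideanSpace ℝ (Fin d), ENNReal.ofReal (g ‖x‖) = 1) (l : ℕ) :
    ∫⁻ y : Fin l → EuclideanSpace ℝ (Fin d), ∏ i, ENNReal.ofReal (g ‖y i‖) = 1 := by
  have := lintegral_prod_pi (ι := Fin l) (volume : Measure (EuclideanSpace ℝ (Fin d)))
    (fun _ x => ENNReal.ofReal (g ‖x‖)) fun _ => by fun_prop
  rw [hg1, Finset.prod_const_one] at this
  rw [← this, volume_pi]

theorem tendsto_kernelIntegral_indicator_of_ae (hh : IsLocalKernel h L) (hg : IsRegVarying g α)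
    (hg1 : ∫⁻ x : EuclideanSpace ℝ (Fin d), ENNReal.ofReal (g ‖x‖) = 1) {l : Filter ℝ}
    [l.IsCountablyGenerated] {F : (Fin (K + 1) → EuclideanSpace ℝ (Fin d)) → ℝ}
    (hF : ∀ᵐ y, Tendsto (fun R => scaledKernel h (fun x => if 1 ≤ x then 1 else 0) R y) l (𝓝 (F y))) :
    Tendsto (kernelIntegral h (fun x => if 1 ≤ x then 1 else 0) g) l
      (𝓝 (∫⁻ y, ENNReal.ofReal (F y) * ∏ i, ENNReal.ofReal (g ‖y i‖))) := by
  refine tendsto_lintegral_filter_of_dominated_convergence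
    (fun y => ∏ i, ENNReal.ofReal (g ‖y i‖)) ?_ ?_ ?_ ?_
  · exact Eventually.of_forall fun R => measurable_scaledKernel_mul_prod hh.measurable
      (isLayerWeight_indicator one_pos).measurable hg.measurable R
  · refine Eventually.of_forall fun R => ae_of_all _ fun y => mul_le_of_le_one_left' ?_
    rw [← ENNReal.ofReal_one]
    exact ENNReal.ofReal_le_ofReal (scaledKernel_indicator_le_one hh R y)
  · rw [lintegral_prod_ofReal_norm hg.measurable hg1]; exact ENNReal.one_ne_top
  · filter_upwards [hF] with y hy
    exact ENNReal.Tendsto.mul_const ((ENNReal.continuous_ofReal.tendsto _).comp hy)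
      (Or.inr (ENNReal.prod_ne_top fun i _ => ENNReal.ofReal_ne_top))

theorem kernelIntegral_indicator_anti (hh : IsLocalKernel h L) {R R' : ℝ} (hR : 0 < R)
    (hRR' : R ≤ R') :
    kernelIntegral h (fun x => if 1 ≤ x then 1 else 0) g R' ≤
      kernelIntegral h (fun x => if 1 ≤ x then 1 else 0) g R := by
  refine lintegral_mono fun y => ?_
  rw [scaledKernel_indicator h hR, scaledKernel_indicator h (hR.trans_le hRR')]
  gcongr
  · exact hh.nonneg y
  · split_ifs with h1 h2
    · exact le_rfl
    · exact absurd (hRR'.trans h1) h2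
    · exact zero_le_one
    · exact le_rfl

theorem continuousAt_kernelIntegral_indicator [NeZero d] (hh : IsLocalKernel h L)
    (hg : IsRegVarying g α)
    (hg1 : ∫⁻ x : EuclideanSpace ℝ (Fin d), ENNReal.ofReal (g ‖x‖) = 1) {R : ℝ} (hR : 0 < R) :
    ContinuousAt (kernelIntegral h (fun x => if 1 ≤ x then 1 else 0) g) R := by
  refine tendsto_kernelIntegral_indicator_of_ae hh hg hg1 ?_
  -- the minimum takes each value with probability zero, as spheres are null sets
  have hae : ∀ᵐ y : Fin (K + 1) → EuclideanSpace ℝ (Fin d), ∀ i, ‖y i‖ ≠ R := by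
    rw [ae_all_iff]
    intro i
    have h1 : ∀ᵐ x : EuclideanSpace ℝ (Fin d), ‖x‖ ≠ R := by
      rw [ae_iff]
      refine measure_mono_null (t := Metric.sphere 0 R) (fun x hx => ?_) (Measure.addHaar_sphere _ _ _)
      simpa using hx
    rw [volume_pi]
    exact (Measure.quasiMeasurePreserving_eval
      (fun _ : Fin (K + 1) => (volume : Measure (EuclideanSpace ℝ (Fin d)))) i).ae h1
  filter_upwards [hae] with y hy
  have hne : (⨅ i, ‖y i‖) ≠ R := by
    obtain ⟨i, hi⟩ := exists_eq_ciInf_of_finite (f := fun i => ‖y i‖)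
    rw [← hi]; exact hy i
  refine tendsto_const_nhds.congr' ?_
  rcases lt_or_gt_of_ne hne with hlt | hlt
  · filter_upwards [lt_mem_nhds hlt, lt_mem_nhds hR] with r hr hr0
    rw [scaledKernel_indicator h hR, scaledKernel_indicator h hr0, if_neg (not_le.2 hlt),
      if_neg (not_le.2 hr)]
  · filter_upwards [gt_mem_nhds hlt, lt_mem_nhds hR] with r hr hr0
    rw [scaledKernel_indicator h hR, scaledKernel_indicator h hr0, if_pos hlt.le, if_pos hr.le]

theorem tendsto_kernelIntegral_indicator_zero (hh : IsLocalKernel h L) (hg : IsRegVarying g α)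
    (hg1 : ∫⁻ x : EuclideanSpace ℝ (Fin d), ENNReal.ofReal (g ‖x‖) = 1) :
    Tendsto (kernelIntegral h (fun x => if 1 ≤ x then 1 else 0) g) atTop (𝓝 0) := by
  have := tendsto_kernelIntegral_indicator_of_ae (l := atTop) (F := fun _ => 0) hh hg hg1
    (ae_of_all _ fun y => by
      refine tendsto_const_nhds.congr' ?_
      filter_upwards [eventually_gt_atTop (⨅ i, ‖y i‖), eventually_gt_atTop 0] with R hR hR0
      rw [scaledKernel_indicator h hR0, if_neg (not_le.2 hR), mul_zero])
  simpa using this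

/-- The asymptotics at infinity give positivity at large scales, and monotonicity carries it down to
every scale. -/
theorem kernelIntegral_indicator_pos [NeZero d] (hh : IsLocalKernel h L) (hI : 0 < shapeIntegral h)
    (hg : IsRegVarying g α) (hα : (d : ℝ) < α) {R : ℝ} (hR : 0 < R) :
    0 < kernelIntegral h (fun x => if 1 ≤ x then 1 else 0) g R := by
  have hd0 : (0 : ℝ) ≤ d := Nat.cast_nonneg d
  have hp : (d : ℝ) < α * (K + 1) := by nlinarith [(Nat.cast_nonneg K : (0 : ℝ) ≤ K)]
  have h1 := (tendsto_kernelIntegral hh (isLayerWeight_indicator one_pos) hg hα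
    tendsto_natCast_atTop_atTop).2
  have h2 := h1.eventually (lt_mem_nhds (mul_pos hI (radialIntegral_indicator_one_pos hp)))
  obtain ⟨n, hn, hnR⟩ := (h2.and (eventually_ge_atTop ⌈R⌉₊)).exists
  refine lt_of_lt_of_le ?_ (kernelIntegral_indicator_anti hh hR (Nat.ceil_le.1 hnR))
  rw [pos_iff_ne_zero]
  intro h0
  rw [h0, ENNReal.toReal_zero, zero_div] at hn
  exact lt_irrefl _ hn

/-- Any null sequence of positive levels is attained by the survival integral along scales tending
to infinity. -/
theorem exists_scale [NeZero d] (hh : IsLocalKernel h L) (hI : 0 < shapeIntegral h)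
    (hg : IsRegVarying g α) (hα : (d : ℝ) < α)
    (hg1 : ∫⁻ x : EuclideanSpace ℝ (Fin d), ENNReal.ofReal (g ‖x‖) = 1) {a : ℕ → ℝ≥0∞}
    (ha : ∀ᶠ n in atTop, a n ≠ 0) (ha0 : Tendsto a atTop (𝓝 0)) :
    ∃ R : ℕ → ℝ, Tendsto R atTop atTop ∧
      ∀ᶠ n in atTop, kernelIntegral h (fun x => if 1 ≤ x then 1 else 0) g (R n) = a n := by
  set S := kernelIntegral h (fun x => if 1 ≤ x then 1 else 0) g with hS
  have hex : ∀ᶠ n in atTop, ∃ R : ℝ, 1 ≤ R ∧ S R = a n := by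
    have h1 := ha0.eventually (gt_mem_nhds
      (kernelIntegral_indicator_pos hh hI hg hα (R := 1) one_pos))
    filter_upwards [ha, h1] with n hn hn1
    obtain ⟨R', hR', hR'1⟩ := (((tendsto_kernelIntegral_indicator_zero hh hg hg1).eventually
      (gt_mem_nhds (pos_iff_ne_zero.2 hn))).and (eventually_ge_atTop 1)).exists
    have hcont : ContinuousOn S (Set.Icc 1 R') := fun r hr =>
      (continuousAt_kernelIntegral_indicator hh hg hg1
        (one_pos.trans_le hr.1)).continuousWithinAt
    obtain ⟨R, hR, hRa⟩ := intermediate_value_Icc' hR'1 hcont ⟨hR'.le, hn1.le⟩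
    exact ⟨R, hR.1, hRa⟩
  classical
  refine ⟨fun n => if hn : ∃ R : ℝ, 1 ≤ R ∧ S R = a n then hn.choose else 0, ?_, ?_⟩
  · rw [tendsto_atTop]
    intro M
    have hM : 0 < max M 1 := lt_max_of_lt_right one_pos
    have h1 := ha0.eventually (gt_mem_nhds (kernelIntegral_indicator_pos hh hI hg hα hM))
    filter_upwards [hex, h1] with n hn hn1
    rw [dif_pos hn]
    by_contra hcon
    have hle : hn.choose ≤ max M 1 := (not_le.1 hcon).le.trans (le_max_left _ _)
    have h2 := kernelIntegral_indicator_anti (g := g) hh (one_pos.trans_le hn.choose_spec.1) hle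
    rw [← hS, hn.choose_spec.2] at h2
    exact absurd hn1 (not_lt.2 h2)
  · filter_upwards [hex] with n hn
    rw [dif_pos hn]
    exact hn.choose_spec.2

end Scale

/-! ### Overlapping pairs -/

/-- The indicator that all points of a tuple are within distance `D` of each other. -/
def diamKernel {d : ℕ} (l : ℕ) (D : ℝ) (y : Fin l → EuclideanSpace ℝ (Fin d)) : ℝ :=
  {y : Fin l → EuclideanSpace ℝ (Fin d) | ∀ i j, dist (y i) (y j) ≤ D}.indicator (fun _ => 1) y

theorem isLocalKernel_diamKernel {d : ℕ} (l : ℕ) {D : ℝ} (hD : 0 < D) :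
    IsLocalKernel (diamKernel (d := d) l D) D where
  measurable := by
    refine measurable_const.indicator (IsClosed.measurableSet ?_)
    simp only [Set.ofPred_forall]
    exact isClosed_iInter fun i => isClosed_iInter fun j =>
      isClosed_le (by fun_prop) continuous_const
  zero_or_one y := by
    rw [diamKernel, Set.indicator_apply]; split_ifs <;> simp
  perm_invariant σ y := by
    simp only [diamKernel, Set.indicator_apply, Set.mem_ofPred_eq]
    congr 1
    rw [eq_iff_iff]
    exact ⟨fun h i j => by simpa using h (σ.symm i) (σ.symm j), fun h i j => h _ _⟩
  translation_invariant x y := by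
    simp [diamKernel, Set.indicator_apply, dist_add_left]
  pos := hD
  dist_le _ hy := Set.mem_of_indicator_ne_zero hy

theorem scaledKernel_perm {d l : ℕ} {h : (Fin l → EuclideanSpace ℝ (Fin d)) → ℝ} {L : ℝ}
    (hh : IsLocalKernel h L) (φ : ℝ → ℝ) (R : ℝ) (σ : Equiv.Perm (Fin l))
    (y : Fin l → EuclideanSpace ℝ (Fin d)) :
    scaledKernel h φ R (fun i => y (σ i)) = scaledKernel h φ R y := by
  rw [scaledKernel, scaledKernel, hh.perm_invariant σ y,
    Equiv.iInf_comp (g := fun i => ‖y i‖) σ]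

theorem layerSum_scaled_eq {d l : ℕ} (h : (Fin l → EuclideanSpace ℝ (Fin d)) → ℝ) (φ : ℝ → ℝ)
    (R : ℝ) (s : Finset (EuclideanSpace ℝ (Fin d))) :
    layerSum h (fun x => φ (x / R)) s = ∑ Y ∈ s.powersetCard l, onSet (scaledKernel h φ R) Y :=
  layerSum_eq_sum_onSet h (fun x => φ (x / R)) s

/-- The weight of an overlapping pair is controlled by a function of the union. -/
theorem onSet_mul_onSet_le {d k : ℕ} {h : (Fin k → EuclideanSpace ℝ (Fin d)) → ℝ} {L c : ℝ}
    {φ : ℝ → ℝ} (hh : IsLocalKernel h L) (hφ : IsLayerWeight φ c) {R : ℝ} (hR : 0 < R)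
    (hRL : 2 * L ≤ c * R) [DecidableEq (EuclideanSpace ℝ (Fin d))]
    {Y Y' : Finset (EuclideanSpace ℝ (Fin d))} (hY : Y.card = k) (hY' : Y'.card = k)
    (hdisj : ¬ Disjoint Y Y') :
    onSet (scaledKernel h φ R) Y * onSet (scaledKernel h φ R) Y' ≤
      onSet (scaledKernel (diamKernel (Y ∪ Y').card (2 * L)) (fun x => φ (2 * x) ^ 2) R)
        (Y ∪ Y') := by
  obtain ⟨w, hwY, hwY'⟩ := Finset.not_disjoint_iff.1 hdisj
  have hval : ∀ {Z : Finset (EuclideanSpace ℝ (Fin d))} (hZ : Z.card = k),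
      onSet (scaledKernel h φ R) Z = onSet h Z * φ (minNorm Z / R) := by
    intro Z hZ
    rw [onSet_of_card_eq _ hZ, onSet_of_card_eq _ hZ, minNorm_eq_iInf hZ, scaledKernel]
  have hrhs : onSet (scaledKernel (diamKernel (Y ∪ Y').card (2 * L)) (fun x => φ (2 * x) ^ 2) R)
      (Y ∪ Y') = diamKernel (Y ∪ Y').card (2 * L)
        (fun i => (((Y ∪ Y').equivFinOfCardEq rfl).symm i : EuclideanSpace ℝ (Fin d))) *
      φ (2 * (minNorm (Y ∪ Y') / R)) ^ 2 := by
    rw [onSet_of_card_eq _ rfl, scaledKernel, ← minNorm_eq_iInf]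
  have hloc : ∀ {Z : Finset (EuclideanSpace ℝ (Fin d))} (hZ : Z.card = k), onSet h Z ≠ 0 →
      ∀ a ∈ Z, ∀ b ∈ Z, dist a b ≤ L := by
    intro Z hZ h0 a ha b hb
    rw [onSet_of_card_eq h hZ] at h0
    have := hh.dist_le _ h0 (Z.equivFinOfCardEq hZ ⟨a, ha⟩) (Z.equivFinOfCardEq hZ ⟨b, hb⟩)
    simpa using this
  have hL := hh.pos
  rw [hrhs, hval hY, hval hY']
  have hrhs0 : 0 ≤ diamKernel (Y ∪ Y').card (2 * L)
        (fun i => (((Y ∪ Y').equivFinOfCardEq rfl).symm i : EuclideanSpace ℝ (Fin d))) *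
      φ (2 * (minNorm (Y ∪ Y') / R)) ^ 2 :=
    mul_nonneg ((isLocalKernel_diamKernel _ (by linarith)).nonneg _) (sq_nonneg _)
  by_cases h0 : onSet h Y * φ (minNorm Y / R) = 0
  · rw [h0, zero_mul]; exact hrhs0
  by_cases h0' : onSet h Y' * φ (minNorm Y' / R) = 0
  · rw [h0', mul_zero]; exact hrhs0
  obtain ⟨hy, hy2⟩ := mul_ne_zero_iff.1 h0
  obtain ⟨hy', hy2'⟩ := mul_ne_zero_iff.1 h0'
  have hw : ∀ a ∈ Y ∪ Y', dist a w ≤ L := by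
    intro a ha
    rcases Finset.mem_union.1 ha with ha | ha
    · exact hloc hY hy a ha w hwY
    · exact hloc hY' hy' a ha w hwY'
  have hdiam : diamKernel (Y ∪ Y').card (2 * L)
      (fun i => (((Y ∪ Y').equivFinOfCardEq rfl).symm i : EuclideanSpace ℝ (Fin d))) = 1 := by
    refine Set.indicator_of_mem (fun i j => ?_) _
    have h1 := hw _ (((Y ∪ Y').equivFinOfCardEq rfl).symm i).2
    have h2 := hw _ (((Y ∪ Y').equivFinOfCardEq rfl).symm j).2
    have h3 := dist_triangle_right (((Y ∪ Y').equivFinOfCardEq rfl).symm i :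
      EuclideanSpace ℝ (Fin d)) (((Y ∪ Y').equivFinOfCardEq rfl).symm j) w
    linarith
  -- both minima are at most `min (Y ∪ Y') + L ≤ 2 min (Y ∪ Y')`
  obtain ⟨v, hv, hvmin⟩ := exists_minNorm_eq (Y := Y ∪ Y') ⟨w, Finset.mem_union_left _ hwY⟩
  have hcR : c * R ≤ ‖v‖ := by
    rcases Finset.mem_union.1 hv with hv | hv
    · exact ((le_div_iff₀ hR).1 (hφ.le_of_ne_zero hy2)).trans (minNorm_le hv)
    · exact ((le_div_iff₀ hR).1 (hφ.le_of_ne_zero hy2')).trans (minNorm_le hv)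
  have hwv : ‖w‖ ≤ 2 * ‖v‖ := by
    have h1 := hw v hv
    rw [dist_comm, dist_eq_norm] at h1
    have h2 := norm_sub_norm_le w v
    linarith
  have hφle : ∀ Z : Finset (EuclideanSpace ℝ (Fin d)), w ∈ Z →
      φ (minNorm Z / R) ≤ φ (2 * (minNorm (Y ∪ Y') / R)) := by
    intro Z hZ
    refine hφ.mono ?_
    rw [hvmin, ← mul_div_assoc]
    gcongr
    exact (minNorm_le hZ).trans hwv
  have hone : ∀ Z : Finset (EuclideanSpace ℝ (Fin d)), onSet h Z ≤ 1 := by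
    intro Z
    rcases onSet_zero_or_one hh.zero_or_one Z with h | h <;> simp [h]
  rw [hdiam, one_mul, sq]
  have hnn := hφ.nonneg
  exact mul_le_mul ((mul_le_of_le_one_left (hnn _) (hone Y)).trans (hφle Y hwY))
    ((mul_le_of_le_one_left (hnn _) (hone Y')).trans (hφle Y' hwY'))
    (mul_nonneg (onSet_nonneg hh.zero_or_one _) (hnn _)) (hnn _)

/-! ### Convergence of the layer sums -/

section LayerSums

variable {Ω : Type*} [MeasurableSpace Ω] {μ : Measure Ω} {d K : ℕ}
  {h : (Fin (K + 1) → EuclideanSpace ℝ (Fin d)) → ℝ} {L α c : ℝ} {g φ : ℝ → ℝ}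

theorem pi_withDensity_norm {n : ℕ} (hg : Measurable g)
    [SigmaFinite ((volume : Measure (EuclideanSpace ℝ (Fin d))).withDensity
      fun x => ENNReal.ofReal (n * g ‖x‖))] (ι : Type) [Fintype ι] :
    Measure.pi (fun _ : ι => (volume : Measure (EuclideanSpace ℝ (Fin d))).withDensity
      fun x => ENNReal.ofReal (n * g ‖x‖)) =
      volume.withDensity fun x => ∏ i, ENNReal.ofReal (n * g ‖x i‖) := by
  rw [volume_pi, pi_withDensity _ (by fun_prop)]

theorem pi_withDensity_diag [NeZero d] {n : ℕ} (hg : Measurable g)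
    [SigmaFinite ((volume : Measure (EuclideanSpace ℝ (Fin d))).withDensity
      fun x => ENNReal.ofReal (n * g ‖x‖))] (ι : Type) [Fintype ι] (i j : ι) (hij : i ≠ j) :
    Measure.pi (fun _ : ι => (volume : Measure (EuclideanSpace ℝ (Fin d))).withDensity
      fun x => ENNReal.ofReal (n * g ‖x‖)) {x | x i = x j} = 0 := by
  rw [pi_withDensity_norm hg]
  exact withDensity_absolutelyContinuous _ _ (volume_setOf_apply_eq_apply NeZero.one_le hij)

theorem IsPoissonProcess.lintegral_sum_scaledKernel [NeZero d] {n l : ℕ}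
    {N : Ω → Finset (EuclideanSpace ℝ (Fin d))}
    (hN : IsPoissonProcess N (volume.withDensity fun x => ENNReal.ofReal (n * g ‖x‖)) μ)
    (hg : Measurable g)
    {h : (Fin l → EuclideanSpace ℝ (Fin d)) → ℝ} (hh : IsLocalKernel h L)
    (hφ : IsLayerWeight φ c) (R : ℝ) :
    ∫⁻ ω, ENNReal.ofReal (∑ Y ∈ (N ω).powersetCard l, onSet (scaledKernel h φ R) Y) ∂μ =
      ENNReal.ofReal (n ^ l / l.factorial) * kernelIntegral h φ g R := by
  have : IsFiniteMeasure ((volume : Measure (EuclideanSpace ℝ (Fin d))).withDensity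
      fun x => ENNReal.ofReal (n * g ‖x‖)) := ⟨hN.finite⟩
  have hm := measurable_scaledKernel hh.measurable hφ.measurable R
  have h1 := hN.lintegral_sum_onSet (pi_withDensity_diag hg _) hm
    (fun y => mul_nonneg (hh.nonneg _) (hφ.nonneg _)) (scaledKernel_perm hh φ R)
  have hf0 : ENNReal.ofReal (l.factorial : ℝ) ≠ 0 := by
    rw [ne_eq, ENNReal.ofReal_eq_zero, not_le]; positivity
  refine (ENNReal.mul_right_inj hf0 ENNReal.ofReal_ne_top).1 ?_
  rw [h1, pi_withDensity_norm hg, lintegral_withDensity_eq_lintegral_mul _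
    (Finset.measurable_fun_prod _ fun i _ => by fun_prop) hm.ennreal_ofReal, ← mul_assoc,
    ← ENNReal.ofReal_mul (by positivity), mul_div_cancel₀ _ (by positivity), kernelIntegral,
    ← lintegral_const_mul' _ _ ENNReal.ofReal_ne_top]
  refine lintegral_congr fun y => ?_
  rw [Pi.mul_apply]
  simp_rw [ENNReal.ofReal_mul (Nat.cast_nonneg n)]
  rw [Finset.prod_mul_distrib, Finset.prod_const, Finset.card_univ, Fintype.card_fin,
    ENNReal.ofReal_pow (Nat.cast_nonneg n), mul_assoc, mul_comm (∏ i, _)]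

theorem IsPoissonProcess.lintegral_sq_sum_scaledKernel_le [NeZero d] {n k : ℕ}
    {N : Ω → Finset (EuclideanSpace ℝ (Fin d))}
    (hN : IsPoissonProcess N (volume.withDensity fun x => ENNReal.ofReal (n * g ‖x‖)) μ)
    (hg : Measurable g)
    {h : (Fin k → EuclideanSpace ℝ (Fin d)) → ℝ} (hh : IsLocalKernel h L)
    (hφ : IsLayerWeight φ c) {R : ℝ} (hR : 0 < R) (hRL : 2 * L ≤ c * R) :
    ∫⁻ ω, ENNReal.ofReal ((∑ Y ∈ (N ω).powersetCard k, onSet (scaledKernel h φ R) Y) ^ 2) ∂μ ≤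
      (ENNReal.ofReal (n ^ k / k.factorial) * kernelIntegral h φ g R) ^ 2 +
      ∑ l ∈ Finset.Ico k (2 * k), ENNReal.ofReal (4 ^ l) * (ENNReal.ofReal (n ^ l / l.factorial) *
        kernelIntegral (diamKernel (d := d) l (2 * L)) (fun x => φ (2 * x) ^ 2) g R) := by
  classical
  have : IsFiniteMeasure ((volume : Measure (EuclideanSpace ℝ (Fin d))).withDensity
      fun x => ENNReal.ofReal (n * g ‖x‖)) := ⟨hN.finite⟩
  have hD : 0 < 2 * L := by have := hh.pos; positivity
  have hm := measurable_scaledKernel hh.measurable hφ.measurable R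
  let G : Finset (EuclideanSpace ℝ (Fin d)) → ℝ := fun Z =>
    onSet (scaledKernel (diamKernel Z.card (2 * L)) (fun x => φ (2 * x) ^ 2) R) Z
  have hGl : ∀ (l : ℕ) (s : Finset (EuclideanSpace ℝ (Fin d))), ∑ Z ∈ s.powersetCard l, G Z =
      ∑ Z ∈ s.powersetCard l,
        onSet (scaledKernel (diamKernel l (2 * L)) (fun x => φ (2 * x) ^ 2) R) Z := by
    intro l s
    refine Finset.sum_congr rfl fun Z hZ => ?_
    obtain ⟨-, rfl⟩ := Finset.mem_powersetCard.1 hZ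
    rfl
  have hG0 : ∀ Z, 0 ≤ G Z := by
    intro Z
    simp only [G]
    rw [onSet_of_card_eq _ rfl]
    exact mul_nonneg ((isLocalKernel_diamKernel _ hD).nonneg _) (sq_nonneg _)
  have hGm : ∀ l, Measurable fun ω => ∑ Z ∈ (N ω).powersetCard l, G Z := by
    intro l
    simp_rw [hGl]
    exact hN.measurable_sum_onSet
      (measurable_scaledKernel (isLocalKernel_diamKernel l hD).measurable
        hφ.sq_comp_two_mul.measurable R)
      (fun y => mul_nonneg ((isLocalKernel_diamKernel _ hD).nonneg _) (sq_nonneg _))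
      (scaledKernel_perm (isLocalKernel_diamKernel l hD) _ R)
  have h1 := hN.lintegral_sq_sum_onSet_le (fun ι _ i j hij => pi_withDensity_diag hg ι i j hij) hm
    (fun y => mul_nonneg (hh.nonneg _) (hφ.nonneg _)) (scaledKernel_perm hh φ R) hG0 hGm
    fun Y Y' hY hY' hd => onSet_mul_onSet_le hh hφ hR hRL hY hY' hd
  rw [hN.lintegral_sum_scaledKernel hg hh hφ R] at h1
  simp_rw [hGl, hN.lintegral_sum_scaledKernel hg (isLocalKernel_diamKernel _ hD)
    hφ.sq_comp_two_mul R] at h1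
  exact h1

/-- The arithmetic behind the negligibility of overlapping pairs. With `p = n g(r)`, the expected
numbers of local `k`-tuples and `l`-tuples at scale `r` have orders `p ^ k * r ^ d` and
`p ^ l * r ^ d`. If the former is of order `m ^ k`, then for `k ≤ l < 2 * k` the latter is of smaller
order than `m ^ (2 * k)`. -/
theorem pow_mul_pow_div_le {p r m C : ℝ} {d k l : ℕ} (hp : 0 ≤ p) (hr : 1 ≤ r) (hm : 1 ≤ m)
    (hC : 1 ≤ C) (hk : 1 ≤ k) (hkl : k ≤ l) (hlk : l < 2 * k) (hb : p ^ k * r ^ d ≤ C * m ^ k) :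
    p ^ l * r ^ d / m ^ (2 * k) ≤ C ^ (l - k + 1) / m := by
  have hm0 : 0 < m := one_pos.trans_le hm
  have hpm : p ≤ C * m := by
    refine le_of_pow_le_pow_left₀ (by omega : k ≠ 0) (by positivity) ?_
    calc p ^ k ≤ p ^ k * r ^ d := le_mul_of_one_le_right (by positivity) (one_le_pow₀ hr)
      _ ≤ C * m ^ k := hb
      _ ≤ (C * m) ^ k := by
        rw [mul_pow]
        gcongr
        exact le_self_pow₀ hC (by omega)
  rw [div_le_div_iff₀ (by positivity) hm0]
  calc p ^ l * r ^ d * m = p ^ (l - k) * (p ^ k * r ^ d) * m := by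
        rw [← mul_assoc, ← pow_add, Nat.sub_add_cancel hkl]
    _ ≤ (C * m) ^ (l - k) * (C * m ^ k) * m := by gcongr
    _ = C ^ (l - k + 1) * m ^ (l + 1) := by
        have hml : m ^ l = m ^ (l - k) * m ^ k := by rw [← pow_add, Nat.sub_add_cancel hkl]
        rw [mul_pow, pow_succ C, pow_succ m, hml]
        ring
    _ ≤ C ^ (l - k + 1) * m ^ (2 * k) := by
        gcongr
        omega

/-- The law of large numbers for layer sums, at a scale `R n` where the expected number of admissible
sets above `R n` is `m ^ (K + 1)`. -/
theorem tendstoInMeasure_layerSum [NeZero d] [IsProbabilityMeasure μ]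
    {P : ℕ → Ω → Finset (EuclideanSpace ℝ (Fin d))}
    (hP : ∀ n : ℕ, 1 ≤ n → IsPoissonProcess (P n)
      (volume.withDensity fun x => ENNReal.ofReal ((n : ℝ) * g ‖x‖)) μ)
    (hh : IsLocalKernel h L) (hI : 0 < shapeIntegral h) (hg : IsRegVarying g α)
    (hα : (d : ℝ) < α) {m : ℕ → ℕ} (hm : Tendsto m atTop atTop) {R : ℕ → ℝ}
    (hR : Tendsto R atTop atTop)
    (hRm : ∀ᶠ n : ℕ in atTop, kernelIntegral h (fun x => if 1 ≤ x then 1 else 0) g (R n) =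
      ENNReal.ofReal ((K + 1).factorial * ((m n : ℝ) / n) ^ (K + 1)))
    (hφ : IsLayerWeight φ c) :
    TendstoInMeasure μ
      (fun n ω => 1 / (m n : ℝ) ^ (K + 1) * layerSum h (fun x => φ (x / R n)) (P n ω)) atTop
      fun _ => radialIntegral d (α * (K + 1)) φ /
        radialIntegral d (α * (K + 1)) (fun x => if 1 ≤ x then 1 else 0) := by
  have hd0 : (0 : ℝ) ≤ d := Nat.cast_nonneg d
  have hp : (d : ℝ) < α * (K + 1) := by nlinarith [(Nat.cast_nonneg K : (0 : ℝ) ≤ K)]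
  set J₁ := radialIntegral d (α * (K + 1)) (fun x => if 1 ≤ x then 1 else 0) with hJ₁
  have hJ₁0 : 0 < J₁ := radialIntegral_indicator_one_pos hp
  have hgR := hR.eventually hg.eventually_pos
  have hn0 : ∀ᶠ n : ℕ in atTop, 1 ≤ n := eventually_ge_atTop 1
  have hm1 : ∀ᶠ n in atTop, 1 ≤ m n := hm.eventually_ge_atTop 1
  have hR1 : ∀ᶠ n in atTop, 1 ≤ R n := hR.eventually_ge_atTop 1
  obtain ⟨hA, hA2⟩ := tendsto_kernelIntegral hh hφ hg hα hR
  have hS2 := (tendsto_kernelIntegral hh (isLayerWeight_indicator one_pos) hg hα hR).2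
  have hSr : ∀ᶠ n : ℕ in atTop,
      (kernelIntegral h (fun x => if 1 ≤ x then 1 else 0) g (R n)).toReal =
      (K + 1).factorial * ((m n : ℝ) / n) ^ (K + 1) := by
    filter_upwards [hRm] with n hn
    rw [hn, ENNReal.toReal_ofReal (by positivity)]
  let δ : ℕ → ℝ≥0∞ := fun n => ∑ l ∈ Finset.Ico (K + 1) (2 * (K + 1)),
    ENNReal.ofReal (((m n : ℝ) ^ (2 * (K + 1)))⁻¹) * (ENNReal.ofReal (4 ^ l) *
      (ENNReal.ofReal ((n : ℝ) ^ l / l.factorial) *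
        kernelIntegral (diamKernel (d := d) l (2 * L)) (fun x => φ (2 * x) ^ 2) g (R n)))
  refine tendstoInMeasure_of_moments (div_nonneg hφ.radialIntegral_nonneg hJ₁0.le)
    (e := fun n => ENNReal.ofReal (((m n : ℝ) ^ (K + 1))⁻¹) *
      (ENNReal.ofReal ((n : ℝ) ^ (K + 1) / (K + 1).factorial) * kernelIntegral h φ g (R n)))
    (δ := δ) ?_ ?_ ?_
  · filter_upwards [hn0, hR1, hR.eventually_ge_atTop (2 * L / c)] with n hn hRn hRL
    have hR0 : 0 < R n := one_pos.trans_le hRn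
    have hRL' : 2 * L ≤ c * R n := (div_le_iff₀' hφ.pos).1 hRL
    have hN := hP n hn
    have hsk0 : ∀ y, 0 ≤ scaledKernel h φ (R n) y := fun y =>
      mul_nonneg (hh.nonneg _) (hφ.nonneg _)
    simp_rw [layerSum_scaled_eq h φ (R n), one_div]
    have hm' := hN.measurable_sum_onSet (measurable_scaledKernel hh.measurable hφ.measurable (R n))
      hsk0 (scaledKernel_perm hh φ (R n))
    have hmi : 0 ≤ ((m n : ℝ) ^ (K + 1))⁻¹ := by positivity
    refine ⟨hm'.const_mul _, fun ω => mul_nonneg hmi (Finset.sum_nonneg fun Y hY => ?_), ?_, ?_⟩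
    · rw [onSet_of_card_eq _ (Finset.mem_powersetCard.1 hY).2]
      exact hsk0 _
    · simp_rw [ENNReal.ofReal_mul hmi]
      rw [lintegral_const_mul' _ _ ENNReal.ofReal_ne_top,
        hN.lintegral_sum_scaledKernel hg.measurable hh hφ]
    · simp_rw [mul_pow, ENNReal.ofReal_mul (pow_nonneg hmi 2)]
      rw [lintegral_const_mul' _ _ ENNReal.ofReal_ne_top]
      refine (mul_le_mul_right (hN.lintegral_sq_sum_scaledKernel_le hg.measurable
        hh hφ hR0 hRL') _).trans_eq ?_
      have hsq : ENNReal.ofReal (((m n : ℝ) ^ (K + 1))⁻¹ ^ 2) =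
          ENNReal.ofReal (((m n : ℝ) ^ (2 * (K + 1)))⁻¹) := by
        rw [inv_pow, ← pow_mul, mul_comm 2]
      rw [mul_add, Finset.mul_sum, hsq]
      congr 1
      rw [← hsq, ENNReal.ofReal_pow hmi, ← mul_pow, mul_pow (ENNReal.ofReal _ : ℝ≥0∞)]
      ring
  · have h1 := hA2.div hS2 (mul_pos hI hJ₁0).ne'
    rw [mul_div_mul_left _ _ hI.ne'] at h1
    refine ((ENNReal.continuous_ofReal.tendsto _).comp h1).congr' ?_
    filter_upwards [hA, hSr, hgR, hn0, hm1, hR1] with n h2 h3 h4 h5 h6 h7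
    have hR0 : 0 < R n := one_pos.trans_le h7
    have hn' : (0 : ℝ) < n := by exact_mod_cast h5
    have hm' : (0 : ℝ) < m n := by exact_mod_cast h6
    have hkI : kernelIntegral h φ g (R n) = ENNReal.ofReal (kernelIntegral h φ g (R n)).toReal :=
      (ENNReal.ofReal_toReal h2).symm
    rw [hkI, ← ENNReal.ofReal_mul (by positivity), ← ENNReal.ofReal_mul (by positivity)]
    simp only [Function.comp, Pi.div_apply]
    congr 1
    rw [div_div_div_cancel_right₀ (by positivity), h3, div_pow]
    field_simp
  · have hzero : (0 : ℝ≥0∞) = ∑ l ∈ Finset.Ico (K + 1) (2 * (K + 1)), 0 := by simp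
    rw [hzero]
    refine tendsto_finsetSum _ fun l hl => ?_
    obtain ⟨hkl, hlk⟩ := Finset.mem_Ico.1 hl
    obtain ⟨l', rfl⟩ : ∃ l', l = l' + 1 := ⟨l - 1, by omega⟩
    have hD : 0 < 2 * L := by have := hh.pos; positivity
    obtain ⟨hB, hB2⟩ := tendsto_kernelIntegral (isLocalKernel_diamKernel (l' + 1) hD)
      hφ.sq_comp_two_mul hg hα hR
    -- `(n g(R))^(K+1) R^d` is at most a constant times `m^(K+1)`
    set C := max ((K + 1).factorial / (shapeIntegral h * J₁ / 2)) 1 with hC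
    have hIJ : 0 < shapeIntegral h * J₁ := mul_pos hI hJ₁0
    have hbound : ∀ᶠ n : ℕ in atTop,
        ((n : ℝ) * g (R n)) ^ (l' + 1) * R n ^ d / (m n : ℝ) ^ (2 * (K + 1)) ≤
          C ^ (l' + 1 - (K + 1) + 1) / m n := by
      filter_upwards [hS2.eventually (lt_mem_nhds (half_lt_self hIJ)), hSr, hgR, hn0, hm1, hR1]
        with n h2 h3 h4 h5 h6 h7
      have hR0 : 0 < R n := one_pos.trans_le h7
      have hn' : (0 : ℝ) < n := by exact_mod_cast h5
      have hm' : (1 : ℝ) ≤ m n := by exact_mod_cast h6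
      refine pow_mul_pow_div_le (mul_nonneg hn'.le (hg.nonneg _)) h7 hm' (le_max_right _ _)
        (by omega) hkl hlk ?_
      rw [h3, lt_div_iff₀ (by positivity), div_pow, ← mul_div_assoc, lt_div_iff₀ (by positivity)]
        at h2
      calc ((n : ℝ) * g (R n)) ^ (K + 1) * R n ^ d =
            (shapeIntegral h * J₁ / 2 * (R n ^ d * g (R n) ^ (K + 1)) * (n : ℝ) ^ (K + 1)) /
              (shapeIntegral h * J₁ / 2) := by
            rw [mul_pow]; field_simp
        _ ≤ ((K + 1).factorial * (m n : ℝ) ^ (K + 1)) / (shapeIntegral h * J₁ / 2) := by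
            gcongr
        _ = (K + 1).factorial / (shapeIntegral h * J₁ / 2) * (m n : ℝ) ^ (K + 1) := by ring
        _ ≤ C * (m n : ℝ) ^ (K + 1) := by
            gcongr
            exact le_max_left _ _
    have hsmall : Tendsto (fun n : ℕ =>
        ((n : ℝ) * g (R n)) ^ (l' + 1) * R n ^ d / (m n : ℝ) ^ (2 * (K + 1))) atTop (𝓝 0) := by
      refine tendsto_of_tendsto_of_tendsto_of_le_of_le' tendsto_const_nhds
        ((tendsto_natCast_atTop_atTop.comp hm).const_div_atTop (C ^ (l' + 1 - (K + 1) + 1)))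
        ?_ hbound
      filter_upwards [hR1] with n hn
      have hR0 : 0 < R n := one_pos.trans_le hn
      have := hg.nonneg (R n)
      positivity
    have h1 := (hsmall.mul hB2).const_mul ((4 : ℝ) ^ (l' + 1) / (l' + 1).factorial)
    rw [zero_mul, mul_zero] at h1
    have h2 := (ENNReal.continuous_ofReal.tendsto _).comp h1
    rw [ENNReal.ofReal_zero] at h2
    refine h2.congr' ?_
    filter_upwards [hB, hgR, hm1, hR1] with n h3 h4 h6 h7
    have hR0 : 0 < R n := one_pos.trans_le h7
    have hm' : (0 : ℝ) < m n := by exact_mod_cast h6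
    rw [← ENNReal.ofReal_toReal h3, ← ENNReal.ofReal_mul (by positivity),
      ← ENNReal.ofReal_mul (by positivity), ← ENNReal.ofReal_mul (by positivity)]
    simp only [Function.comp]
    congr 1
    rw [mul_pow]
    field_simp

end LayerSums

/-! ### Convergence of the estimator -/

theorem tendsto_measure_le_of_tendstoInMeasure {Ω : Type*} [MeasurableSpace Ω] {μ : Measure Ω}
    {X : ℕ → Ω → ℝ} {c t : ℝ} (hX : TendstoInMeasure μ X atTop fun _ => c) (ht : c < t) :
    Tendsto (fun n => μ {ω | t ≤ X n ω}) atTop (𝓝 0) := by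
  rw [tendstoInMeasure_iff_norm] at hX
  refine tendsto_of_tendsto_of_tendsto_of_le_of_le tendsto_const_nhds (hX _ (sub_pos.2 ht))
    (fun _ => zero_le) fun n => measure_mono fun ω hω => ?_
  have hω : t ≤ X n ω := hω
  exact (sub_le_sub_right hω c).trans (le_abs_self _)

theorem tendsto_measure_ge_of_tendstoInMeasure {Ω : Type*} [MeasurableSpace Ω] {μ : Measure Ω}
    {X : ℕ → Ω → ℝ} {c t : ℝ} (hX : TendstoInMeasure μ X atTop fun _ => c) (ht : t < c) :
    Tendsto (fun n => μ {ω | X n ω ≤ t}) atTop (𝓝 0) := by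
  rw [tendstoInMeasure_iff_norm] at hX
  refine tendsto_of_tendsto_of_tendsto_of_le_of_le tendsto_const_nhds (hX _ (sub_pos.2 ht))
    (fun _ => zero_le) fun n => measure_mono fun ω hω => ?_
  have hω : X n ω ≤ t := hω
  have := neg_abs_le (X n ω - c)
  change c - t ≤ |X n ω - c|
  linarith

theorem tendstoInMeasure_comp_of_continuousAt {Ω : Type*} [MeasurableSpace Ω] {μ : Measure Ω}
    {X : ℕ → Ω → ℝ} {c : ℝ} (hX : TendstoInMeasure μ X atTop fun _ => c) {F : ℝ → ℝ}
    (hF : ContinuousAt F c) : TendstoInMeasure μ (fun n ω => F (X n ω)) atTop fun _ => F c := by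
  rw [tendstoInMeasure_iff_norm] at hX ⊢
  intro ε hε
  obtain ⟨δ, hδ, hδF⟩ := Metric.continuousAt_iff.1 hF ε hε
  refine tendsto_of_tendsto_of_tendsto_of_le_of_le tendsto_const_nhds (hX δ hδ)
    (fun _ => zero_le) fun n => measure_mono fun ω hω => ?_
  by_contra hcon
  exact absurd (hδF (not_le.1 hcon)) (not_lt.2 hω)

/-- Consistency of the estimator in terms of the radial profile `g` of the density. -/
theorem tendstoInMeasure_hill {Ω : Type*} [MeasurableSpace Ω] {μ : Measure Ω}
    [IsProbabilityMeasure μ] {d K : ℕ} [NeZero d]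
    {h : (Fin (K + 1) → EuclideanSpace ℝ (Fin d)) → ℝ} {L α : ℝ} {g : ℝ → ℝ}
    {P : ℕ → Ω → Finset (EuclideanSpace ℝ (Fin d))}
    (hP : ∀ n : ℕ, 1 ≤ n → IsPoissonProcess (P n)
      (volume.withDensity fun x => ENNReal.ofReal ((n : ℝ) * g ‖x‖)) μ)
    (hh : IsLocalKernel h L) (hI : 0 < shapeIntegral h) (hg : IsRegVarying g α)
    (hα : (d : ℝ) < α)
    (hg1 : ∫⁻ x : EuclideanSpace ℝ (Fin d), ENNReal.ofReal (g ‖x‖) = 1)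
    {m : ℕ → ℕ} (hm : Tendsto m atTop atTop)
    (hmn : Tendsto (fun n : ℕ => (m n : ℝ) / (n : ℝ)) atTop (𝓝 0)) :
    TendstoInMeasure μ (fun n ω => hill h (m n) (P n ω)) atTop
      fun _ => 1 / (α * (K + 1) - d) := by
  have hd0 : (0 : ℝ) ≤ d := Nat.cast_nonneg d
  have hp : (d : ℝ) < α * (K + 1) := by nlinarith [(Nat.cast_nonneg K : (0 : ℝ) ≤ K)]
  set β := α * (K + 1) - d with hβd
  have hβ : 0 < β := by linarith
  have hm1 : ∀ᶠ n in atTop, 1 ≤ m n := hm.eventually_ge_atTop 1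
  obtain ⟨R, hR, hRm⟩ := exists_scale hh hI hg hα hg1
    (a := fun n => ENNReal.ofReal ((K + 1).factorial * ((m n : ℝ) / n) ^ (K + 1)))
    (by
      filter_upwards [hm1, eventually_ge_atTop 1] with n h1 h2
      have hn' : (0 : ℝ) < n := by exact_mod_cast h2
      have hm' : (0 : ℝ) < m n := by exact_mod_cast h1
      exact (ENNReal.ofReal_pos.2 (by positivity)).ne')
    (by
      have h1 := ((hmn.pow (K + 1)).const_mul ((K + 1).factorial : ℝ))
      rw [zero_pow (by omega), mul_zero] at h1
      have h2 := (ENNReal.continuous_ofReal.tendsto _).comp h1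
      rwa [ENNReal.ofReal_zero] at h2)
  have hcount : ∀ c : ℝ, 0 < c → TendstoInMeasure μ (fun n ω => 1 / (m n : ℝ) ^ (K + 1) *
      layerSum h (fun x => if c ≤ x / R n then 1 else 0) (P n ω)) atTop fun _ => c ^ (-β) := by
    intro c hc
    have := tendstoInMeasure_layerSum hP hh hI hg hα hm hR hRm (isLayerWeight_indicator hc)
    rwa [radialIntegral_indicator_div hp hc] at this
  have hlog : ∀ c : ℝ, 0 < c → TendstoInMeasure μ (fun n ω => 1 / (m n : ℝ) ^ (K + 1) *
      layerSum h (fun x => Real.log (max (x / R n / c) 1)) (P n ω)) atTop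
        fun _ => c ^ (-β) / β := by
    intro c hc
    have := tendstoInMeasure_layerSum hP hh hI hg hα hm hR hRm (isLayerWeight_log hc)
    rwa [radialIntegral_log_div hp hc] at this
  rw [tendstoInMeasure_iff_norm]
  intro ε hε
  -- With high probability the order statistic lies between `a R n` and `b R n` for any
  -- `a < 1 < b`; these are taken so close to `1` that both limits `c ^ (-β) / β` of the
  -- bounding layer sums are within `ε` of `1 / β`.
  have hcont : Tendsto (fun b : ℝ => b ^ (-β) / β) (𝓝 1) (𝓝 (1 / β)) := by
    have := (Real.continuousAt_rpow_const (1 : ℝ) (-β) (Or.inl one_ne_zero)).tendsto.div_const β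
    rwa [Real.one_rpow] at this
  have hev := hcont.eventually (Metric.ball_mem_nhds _ hε)
  obtain ⟨b, hb, hb1⟩ : ∃ b : ℝ, b ^ (-β) / β ∈ Metric.ball (1 / β) ε ∧ 1 < b :=
    ((hev.filter_mono nhdsWithin_le_nhds).and
      (self_mem_nhdsWithin : Set.Ioi (1 : ℝ) ∈ 𝓝[>] 1)).exists
  obtain ⟨a, ⟨ha, ha0⟩, ha1⟩ : ∃ a : ℝ, (a ^ (-β) / β ∈ Metric.ball (1 / β) ε ∧ 0 < a) ∧ a < 1 :=
    (((hev.and (lt_mem_nhds one_pos)).filter_mono nhdsWithin_le_nhds).and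
      (self_mem_nhdsWithin : Set.Iio (1 : ℝ) ∈ 𝓝[<] 1)).exists
  have hb0 : 0 < b := one_pos.trans hb1
  rw [Metric.mem_ball, Real.dist_eq, abs_lt] at ha hb
  have e1 := tendsto_measure_ge_of_tendstoInMeasure (t := 1) (hcount a ha0)
    (Real.one_lt_rpow_of_pos_of_lt_one_of_neg ha0 ha1 (by linarith))
  have e2 := tendsto_measure_le_of_tendstoInMeasure (t := 1) (hcount b hb0)
    (Real.rpow_lt_one_of_one_lt_of_neg hb1 (by linarith))
  have e3 := tendsto_measure_le_of_tendstoInMeasure (t := 1 / β + ε) (hlog a ha0) (by linarith)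
  have e4 := tendsto_measure_ge_of_tendstoInMeasure (t := 1 / β - ε) (hlog b hb0) (by linarith)
  have hsum := ((e1.add e2).add e3).add e4
  simp only [add_zero] at hsum
  refine tendsto_of_tendsto_of_tendsto_of_le_of_le' tendsto_const_nhds hsum
    (Eventually.of_forall fun _ => zero_le) ?_
  filter_upwards [hm1, hR.eventually_gt_atTop 0] with n hmn hRn
  refine le_trans (measure_mono fun ω hω => ?_) ((measure_union_le _ _).trans (add_le_add_left
    ((measure_union_le _ _).trans (add_le_add_left (measure_union_le _ _) _)) _))
  have hω : ε ≤ ‖hill h (m n) (P n ω) - 1 / β‖ := hω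
  by_contra hcon
  simp only [Set.mem_union, Set.mem_ofPred_eq, not_or, not_le] at hcon
  obtain ⟨⟨⟨c1, c2⟩, c3⟩, c4⟩ := hcon
  have hmk : (0 : ℝ) < (m n : ℝ) ^ (K + 1) := by
    have : (0 : ℝ) < m n := by exact_mod_cast hmn
    positivity
  have hmk1 : 1 ≤ m n ^ (K + 1) := Nat.one_le_pow _ _ hmn
  have hcnt : ∀ c : ℝ, 0 < c → (R n * c ≤ orderStat h (P n ω) (m n ^ (K + 1)) ↔
      1 ≤ 1 / (m n : ℝ) ^ (K + 1) *
        layerSum h (fun x => if c ≤ x / R n then 1 else 0) (P n ω)) := by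
    intro c hc
    rw [le_orderStat_iff_layerSum hh.zero_or_one (P n ω) hmk1 (mul_pos hRn hc), one_div,
      ← div_eq_inv_mul, one_le_div hmk, Nat.cast_pow]
    simp_rw [le_div_iff₀' hRn]
  have hUa := (hcnt a ha0).2 c1.le
  have hUb := (not_le.1 (mt (hcnt b hb0).1 (not_le.2 c2))).le
  obtain ⟨h1, h2⟩ := hill_bounds hh.zero_or_one (m n) (P n ω) (mul_pos hRn ha0) hUa hUb
  simp_rw [← div_div] at h1 h2
  refine absurd hω (not_le.2 ?_)
  rw [Real.norm_eq_abs, abs_lt]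
  constructor <;> linarith

theorem IsAdmissible.exists_isLocalKernel {d K : ℕ}
    {h : (Fin (K + 1) → EuclideanSpace ℝ (Fin d)) → ℝ} (hh : IsAdmissible h) :
    ∃ L, IsLocalKernel h L := by
  obtain ⟨L, hL, hsupp⟩ := hh.local_support
  refine ⟨L, hh.measurable, hh.zero_or_one, hh.perm_invariant, hh.translation_invariant, hL,
    fun y hy i j => ?_⟩
  have h1 : Metric.diam (Set.range y) ≤ L := not_lt.1 (mt (hsupp y) hy)
  exact (Metric.dist_le_diam_of_mem (Set.finite_range y).isBounded (Set.mem_range_self i)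
    (Set.mem_range_self j)).trans h1

theorem IsAdmissible.shapeIntegral_pos {d K : ℕ}
    {h : (Fin (K + 1) → EuclideanSpace ℝ (Fin d)) → ℝ} (hh : IsAdmissible h) :
    0 < shapeIntegral h := by
  have h1 : ∀ z : Fin K → EuclideanSpace ℝ (Fin d),
      (consZero (k := K + 1) z) = Fin.cons 0 z := by
    intro z
    funext i
    refine Fin.cases ?_ (fun j => ?_) i
    · simp [consZero]
    · simp [consZero]
  have h2 : 0 < ∫ z : Fin K → EuclideanSpace ℝ (Fin d), h (consZero (k := K + 1) z) :=
    hh.integral_pos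
  simp only [h1] at h2
  exact h2

/-- The radial profile of a spherically symmetric density. -/
theorem IsRegVaryingDensity.exists_profile {d : ℕ} (hd : 1 ≤ d)
    {f : EuclideanSpace ℝ (Fin d) → ℝ} {α : ℝ} (hf : IsRegVaryingDensity f α) :
    ∃ g : ℝ → ℝ, IsRegVarying g α ∧ ∀ x, f x = g ‖x‖ := by
  let v : EuclideanSpace ℝ (Fin d) := EuclideanSpace.single ⟨0, hd⟩ 1
  have hv : ‖v‖ = 1 := by simp [v]
  refine ⟨fun r => f (r • v), ⟨hf.measurable.comp (by fun_prop), fun r => hf.nonneg _,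
    fun r hr => hf.tail v hv r hr⟩, fun x => hf.spherically_symmetric _ _ ?_⟩
  rw [norm_smul, hv, mul_one, norm_norm]

end LayeredHill

end

theorem theoremt {Ω : Type*} [MeasurableSpace Ω] (μ : Measure Ω) [IsProbabilityMeasure μ]
    (d : ℕ) (hd : 1 ≤ d) (α : ℝ) (f : EuclideanSpace ℝ (Fin d) → ℝ)
    (hf : LayeredHill.IsRegVaryingDensity f α)
    (P : ℕ → Ω → Finset (EuclideanSpace ℝ (Fin d)))
    (hP : ∀ n : ℕ, 1 ≤ n → LayeredHill.IsPoissonProcess (P n)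
      (volume.withDensity fun x => ENNReal.ofReal ((n : ℝ) * f x)) μ)
    (m : ℕ → ℕ) (hm_pos : ∀ n : ℕ, 1 ≤ n → 1 ≤ m n) (hm_top : Tendsto m atTop atTop)
    (hm_div : Tendsto (fun n : ℕ => (m n : ℝ) / (n : ℝ)) atTop (𝓝 0))
    (k : ℕ) (hk : 1 ≤ k) (h : (Fin k → EuclideanSpace ℝ (Fin d)) → ℝ)
    (hh : LayeredHill.IsAdmissible h) :
    TendstoInMeasure μ (fun (n : ℕ) (ω : Ω) => LayeredHill.hill h (m n) (P n ω)) atTop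
        (fun _ => 1 / (α * (k : ℝ) - (d : ℝ))) ∧
      TendstoInMeasure μ
        (fun (n : ℕ) (ω : Ω) =>
          (d : ℝ) / (k : ℝ) + ((k : ℝ) * LayeredHill.hill h (m n) (P n ω))⁻¹) atTop
        (fun _ => α) := by
  obtain ⟨K, rfl⟩ : ∃ K, k = K + 1 := ⟨k - 1, by omega⟩
  have : NeZero d := ⟨by omega⟩
  obtain ⟨g, hg, hfg⟩ := hf.exists_profile hd
  obtain ⟨L, hL⟩ := hh.exists_isLocalKernel
  have hone := hf.lintegral_eq_one
  simp only [hfg] at hP hone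
  have hα := hf.lt_exponent
  have h1 := LayeredHill.tendstoInMeasure_hill hP hL hh.shapeIntegral_pos hg hα hone hm_top hm_div
  have hd0 : (0 : ℝ) ≤ d := Nat.cast_nonneg d
  have hK0 : (0 : ℝ) ≤ K := Nat.cast_nonneg K
  have hβ : 0 < α * (K + 1) - d := by nlinarith
  have hK : (0 : ℝ) < (K : ℝ) + 1 := by positivity
  simp only [Nat.cast_add, Nat.cast_one]
  refine ⟨h1, ?_⟩
  have hF : ContinuousAt (fun x : ℝ => (d : ℝ) / ((K : ℝ) + 1) + (((K : ℝ) + 1) * x)⁻¹)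
      (1 / (α * (K + 1) - d)) := by
    refine continuousAt_const.add (ContinuousAt.inv₀ (by fun_prop) ?_)
    positivity
  have h2 := LayeredHill.tendstoInMeasure_comp_of_continuousAt h1 hF
  have hval : (d : ℝ) / ((K : ℝ) + 1) + (((K : ℝ) + 1) * (1 / (α * (K + 1) - d)))⁻¹ = α := by
    field_simp
    ring
  simpa only [hval] using h2
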